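/- Let $G$ be a (finite-dimensional, real) Lie group with Lie algebra $\mathfrak g=T_1G$, and let $\pi:P\to M$ be a smooth right principal $G$-bundle, with action $\psi_g(p)=p\cdot g$ and infinitesimal generators $u_P$ ($u\in\mathfrak g$). The gauge groupoid $\mathcal G(P)\rightrightarrows M$ is the quotient manifold $(P\times P)/G$ by the diagonal action, with classes $\overline{(p,q)}$, target $\overline{(p,q)}\mapsto\pi(p)$, source $\overline{(p,q)}\mapsto\pi(q)$ and multiplication $\overline{(p,q)}\cdot\overline{(q,r)}=\overline{(p,r)}$; its tangent groupoid $T\mathcal G(P)\rightrightarrows TM$ has as structure maps the tangent maps of those of $\mathcal G(P)$. For $X,Y\in TP$ let $\overline{(X,Y)}\in T\mathcal G(P)$ denote the image of $(X,Y)$ under the tangent map of the quotient map $P\times P\to\mathcal G(P)$. Let $V\subseteq TP$ be the vertical bundle, $V_p=\{u_P(p): u\in\mathfrak g\}$, and $\Delta_V=\{\overline{(X,Y)}: X,Y\in V\}\subseteq T\mathcal G(P)$. A vector-valued 1-form $K\in\Omega^1(\mathcal G(P),T\mathcal G(P))$ is a smooth vector bundle endomorphism $K:T\mathcal G(P)\to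 T\mathcal G(P)$ over the identity; it is multiplicative if there is $K_M\in\Omega^1(M,TM)$ such that $(K,K_M)$ is a morphism of the groupoid $T\mathcal G(P)\rightrightarrows TM$. A principal connection is a smooth $\theta\in\Omega^1(P,\mathfrak g)$ with $\theta(u_P)=u$ for all $u\in\mathfrak g$ and $\psi_g^*\theta=\mathrm{Ad}_{g^{-1}}\theta$ for all $g\in G$; put $\Theta(X)=(\theta(X))_P(p)$ for $X\in T_pP$. Then there is a one-to-one correspondence $\theta\mapsto K$ between the principal connections $\theta\in\Omega^1(P,\mathfrak g)$ on $P$ and the multiplicative vector-valued 1-forms $K\in\Omega^1(\mathcal G(P),T\mathcal G(P))$ that satisfy $K^2=K$ and $\mathrm{Im}(K)=\Delta_V$. It is given by $$K\big(\overline{(X,Y)}\big)=\overline{(\Theta(X),\Theta(Y))}\qquad\text{for all }X,Y\in TP .$$ -/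

import Mathlib

open Set Topology Bundle
open scoped Manifold ContDiff

noncomputable section

/-! ### Principal bundles -/

section PrincipalBundle

variable {EM : Type*} [NormedAddCommGroup EM] [NormedSpace ℝ EM]
  {HM : Type*} [TopologicalSpace HM] (IM : ModelWithCorners ℝ EM HM)
  {EP : Type*} [NormedAddCommGroup EP] [NormedSpace ℝ EP]
  {HP : Type*} [TopologicalSpace HP] (IP : ModelWithCorners ℝ EP HP)
  {EG : Type*} [NormedAddCommGroup EG] [NormedSpace ℝ EG]
  {HG : Type*} [TopologicalSpace HG] (IG : ModelWithCorners ℝ EG HG)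
  (M : Type*) [TopologicalSpace M] [ChartedSpace HM M]
  (P : Type*) [TopologicalSpace P] [ChartedSpace HP P]
  (G : Type*) [TopologicalSpace G] [ChartedSpace HG G] [Group G]

/-- A smooth (right) principal `G`-bundle `proj : P → M`: a smooth right action `act` of `G` on `P`
such that `M` is covered by open sets over which `P` admits a `G`-equivariant diffeomorphism onto
`baseSet × G` commuting with the projections (`G` acting on the second factor by right
multiplication). -/
structure PrincipalBundle where
  proj : P → M
  act : P → G → P
  act_one : ∀ p, act p 1 = p
  act_mul : ∀ p g h, act p (g * h) = act (act p g) h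
  contMDiff_act : ContMDiff (IP.prod IG) IP ∞ (fun z : P × G => act z.1 z.2)
  contMDiff_proj : ContMDiff IP IM ∞ proj
  proj_act : ∀ p g, proj (act p g) = proj p
  exists_trivialization : ∀ x : M, ∃ e : Trivialization G proj, x ∈ e.baseSet ∧
    ContMDiffOn IP (IM.prod IG) ∞ e e.source ∧
    ContMDiffOn (IM.prod IG) IP ∞ e.toOpenPartialHomeomorph.symm e.target ∧
    ∀ p ∈ e.source, ∀ g, e (act p g) = (proj p, (e p).2 * g)

end PrincipalBundle

/-! ### Vector-valued one-forms, groupoids and multiplicativity -/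

section Forms

variable {E : Type*} [NormedAddCommGroup E] [NormedSpace ℝ E]
  {H : Type*} [TopologicalSpace H] (I : ModelWithCorners ℝ E H)
  (N : Type*) [TopologicalSpace N] [ChartedSpace H N] [IsManifold I ∞ N]

/-- An element of `Ω¹(N, TN)`: a smooth endomorphism of the vector bundle `TN` covering the
identity of `N`. -/
@[ext]
structure VectorValuedOneForm where
  toFun : ∀ x : N, TangentSpace I x →L[ℝ] TangentSpace I x
  contMDiff_toFun : ContMDiff I.tangent I.tangent ∞
    (fun v : TangentBundle I N => (⟨v.1, toFun v.1 v.2⟩ : TangentBundle I N))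

variable {I N}

/-- The bundle map `TN → TN` given by a vector-valued one-form. -/
def VectorValuedOneForm.map (K : VectorValuedOneForm I N) (v : TangentBundle I N) :
    TangentBundle I N :=
  ⟨v.1, K.toFun v.1 v.2⟩

variable (I)

/-- The velocity at time `0` of a curve. -/
def velocity (γ : ℝ → N) : TangentBundle I N :=
  tangentMap 𝓘(ℝ, ℝ) I γ ⟨0, (1 : ℝ)⟩

end Forms

/-- A groupoid `𝒢 ⇉ M` with space of arrows `𝒢` and space of objects `M`. The product `g h` is
defined when `src g = tgt h`. -/
structure GroupoidStructure (M 𝒢 : Type*) where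
  src : 𝒢 → M
  tgt : 𝒢 → M
  mul : ∀ g h : 𝒢, src g = tgt h → 𝒢
  unit : M → 𝒢
  inv : 𝒢 → 𝒢
  src_mul : ∀ g h e, src (mul g h e) = src h
  tgt_mul : ∀ g h e, tgt (mul g h e) = tgt g
  src_unit : ∀ x, src (unit x) = x
  tgt_unit : ∀ x, tgt (unit x) = x
  src_inv : ∀ g, src (inv g) = tgt g
  tgt_inv : ∀ g, tgt (inv g) = src g
  mul_assoc : ∀ (g h k : 𝒢) (e₁ : src g = tgt h) (e₂ : src h = tgt k),
    mul (mul g h e₁) k ((src_mul g h e₁).trans e₂)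
      = mul g (mul h k e₂) (e₁.trans (tgt_mul h k e₂).symm)
  unit_mul : ∀ g, mul (unit (tgt g)) g (src_unit (tgt g)) = g
  mul_unit : ∀ g, mul g (unit (src g)) (tgt_unit (src g)).symm = g
  inv_mul : ∀ g, mul (inv g) g (src_inv g) = unit (src g)
  mul_inv : ∀ g, mul g (inv g) (tgt_inv g).symm = unit (tgt g)

section Multiplicative

variable {EM : Type*} [NormedAddCommGroup EM] [NormedSpace ℝ EM]
  {HM : Type*} [TopologicalSpace HM] {IM : ModelWithCorners ℝ EM HM}
  {E : Type*} [NormedAddCommGroup E] [NormedSpace ℝ E]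
  {H : Type*} [TopologicalSpace H] {I : ModelWithCorners ℝ E H}
  {M : Type*} [TopologicalSpace M] [ChartedSpace HM M] [IsManifold IM ∞ M]
  {𝒢 : Type*} [TopologicalSpace 𝒢] [ChartedSpace H 𝒢] [IsManifold I ∞ 𝒢]

variable (I) in
/-- The graph of the multiplication `Tm : T(𝒢⁽²⁾) → T𝒢` of the tangent groupoid: `(X, Y)` is the
velocity of a smooth curve `(γ, δ)` of composable pairs of arrows, and `Z = Tm (X, Y)` is the
velocity of the curve `t ↦ γ t · δ t`. -/
def GroupoidStructure.IsTangentMul (𝓖 : GroupoidStructure M 𝒢) (X Y Z : TangentBundle I 𝒢) :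
    Prop :=
  ∃ (γ δ : ℝ → 𝒢) (h : ∀ t, 𝓖.src (γ t) = 𝓖.tgt (δ t)),
    ContMDiff 𝓘(ℝ, ℝ) I ∞ γ ∧ ContMDiff 𝓘(ℝ, ℝ) I ∞ δ ∧
    velocity I γ = X ∧ velocity I δ = Y ∧
    velocity I (fun t => 𝓖.mul (γ t) (δ t) (h t)) = Z

variable (IM) in
/-- `K ∈ Ω¹(𝒢, T𝒢)` is multiplicative: there is `K_M ∈ Ω¹(M, TM)` such that `(K, K_M)` is a
morphism from the tangent groupoid `T𝒢 ⇉ TM` to itself. -/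
def GroupoidStructure.IsMultiplicative (𝓖 : GroupoidStructure M 𝒢)
    (K : VectorValuedOneForm I 𝒢) : Prop :=
  ∃ K_M : VectorValuedOneForm IM M,
    (∀ X, tangentMap I IM 𝓖.src (K.map X) = K_M.map (tangentMap I IM 𝓖.src X)) ∧
    (∀ X, tangentMap I IM 𝓖.tgt (K.map X) = K_M.map (tangentMap I IM 𝓖.tgt X)) ∧
    ∀ X Y Z, 𝓖.IsTangentMul I X Y Z → 𝓖.IsTangentMul I (K.map X) (K.map Y) (K.map Z)

end Multiplicative

namespace PrincipalBundle

variable {EM : Type*} [NormedAddCommGroup EM] [NormedSpace ℝ EM]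
  {HM : Type*} [TopologicalSpace HM] {IM : ModelWithCorners ℝ EM HM}
  {EP : Type*} [NormedAddCommGroup EP] [NormedSpace ℝ EP]
  {HP : Type*} [TopologicalSpace HP] {IP : ModelWithCorners ℝ EP HP}
  {EG : Type*} [NormedAddCommGroup EG] [NormedSpace ℝ EG]
  {HG : Type*} [TopologicalSpace HG] {IG : ModelWithCorners ℝ EG HG}
  {M : Type*} [TopologicalSpace M] [ChartedSpace HM M]
  {P : Type*} [TopologicalSpace P] [ChartedSpace HP P]
  {G : Type*} [TopologicalSpace G] [ChartedSpace HG G] [Group G]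

/-! ### The gauge groupoid as a set -/

section Algebra

variable (B : PrincipalBundle IM IP IG M P G)

theorem act_eq_self {p : P} {g : G} (h : B.act p g = p) : g = 1 := by
  obtain ⟨e, hx, -, -, he⟩ := B.exists_trivialization (B.proj p)
  have := he p (e.mem_source.2 hx) g
  rw [h] at this
  have h2 := congrArg Prod.snd this
  simpa using h2

theorem exists_act_eq {p q : P} (h : B.proj p = B.proj q) : ∃ g, B.act p g = q := by
  obtain ⟨e, hx, -, -, he⟩ := B.exists_trivialization (B.proj p)
  have hp : p ∈ e.source := e.mem_source.2 hx
  have hq : q ∈ e.source := e.mem_source.2 (h ▸ hx)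
  refine ⟨(e p).2⁻¹ * (e q).2, e.injOn (e.mem_source.2 ?_) hq ?_⟩
  · rwa [B.proj_act]
  · change e _ = e q
    rw [he p hp, mul_inv_cancel_left, h, e.mk_proj_snd hq]

/-- The orbit relation of the diagonal action of `G` on `P × P`. -/
def diagonalSetoid : Setoid (P × P) where
  r z w := ∃ g, w = (B.act z.1 g, B.act z.2 g)
  iseqv :=
    { refl := fun z => ⟨1, by simp [B.act_one]⟩
      symm := by
        rintro z w ⟨g, rfl⟩
        exact ⟨g⁻¹, by simp [← B.act_mul, B.act_one]⟩
      trans := by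
        rintro z w v ⟨g, rfl⟩ ⟨h, rfl⟩
        exact ⟨g * h, by simp [B.act_mul]⟩ }

/-- The space of arrows `𝒢(P) = (P × P) / G` of the gauge groupoid. -/
def GaugeSpace : Type _ := Quotient B.diagonalSetoid

/-- The quotient map `(p, q) ↦ \overline{(p, q)}`. -/
def toGauge (z : P × P) : B.GaugeSpace := Quotient.mk B.diagonalSetoid z

theorem toGauge_surjective : Function.Surjective B.toGauge := Quotient.mk_surjective

theorem toGauge_eq_iff {z w : P × P} :
    B.toGauge z = B.toGauge w ↔ ∃ g, w = (B.act z.1 g, B.act z.2 g) :=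
  ⟨fun h => Quotient.exact h, fun h => Quotient.sound h⟩

theorem toGauge_act (p q : P) (g : G) : B.toGauge (B.act p g, B.act q g) = B.toGauge (p, q) :=
  ((B.toGauge_eq_iff (z := (p, q))).2 ⟨g, rfl⟩).symm

/-- The target map `\overline{(p, q)} ↦ π p`. -/
def tgt : B.GaugeSpace → M :=
  Quotient.lift (fun z => B.proj z.1) (by rintro z w ⟨g, rfl⟩; exact (B.proj_act _ _).symm)

/-- The source map `\overline{(p, q)} ↦ π q`. -/
def src : B.GaugeSpace → M :=
  Quotient.lift (fun z => B.proj z.2) (by rintro z w ⟨g, rfl⟩; exact (B.proj_act _ _).symm)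

@[simp] theorem tgt_toGauge (z : P × P) : B.tgt (B.toGauge z) = B.proj z.1 := rfl

@[simp] theorem src_toGauge (z : P × P) : B.src (B.toGauge z) = B.proj z.2 := rfl

theorem exists_mul (z w : B.GaugeSpace) (h : B.src z = B.tgt w) :
    ∃ v, ∃ p q r, z = B.toGauge (p, q) ∧ w = B.toGauge (q, r) ∧ v = B.toGauge (p, r) := by
  obtain ⟨⟨p, q⟩, rfl⟩ := B.toGauge_surjective z
  obtain ⟨⟨q', r'⟩, rfl⟩ := B.toGauge_surjective w
  obtain ⟨g, rfl⟩ := B.exists_act_eq (p := q') (q := q) (by simpa using h.symm)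
  exact ⟨_, p, _, B.act r' g, rfl, (B.toGauge_act _ _ _).symm, rfl⟩

/-- The multiplication `\overline{(p, q)} · \overline{(q, r)} = \overline{(p, r)}`; see
`gaugeMul_toGauge`. -/
def gaugeMul (z w : B.GaugeSpace) (h : B.src z = B.tgt w) : B.GaugeSpace :=
  (B.exists_mul z w h).choose

theorem gaugeMul_toGauge (p q r : P) (h : B.src (B.toGauge (p, q)) = B.tgt (B.toGauge (q, r))) :
    B.gaugeMul (B.toGauge (p, q)) (B.toGauge (q, r)) h = B.toGauge (p, r) := by
  obtain ⟨p', q', r', h1, h2, h3⟩ := (B.exists_mul _ _ h).choose_spec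
  obtain ⟨g, hg⟩ := B.toGauge_eq_iff.1 h1
  obtain ⟨k, hk⟩ := B.toGauge_eq_iff.1 h2
  simp only [Prod.mk.injEq] at hg hk
  obtain ⟨rfl, rfl⟩ := hg
  obtain ⟨hq, rfl⟩ := hk
  have : g = k := by
    have : B.act q (g * k⁻¹) = q := by
      rw [B.act_mul, hq, ← B.act_mul, mul_inv_cancel, B.act_one]
    exact mul_inv_eq_one.1 (B.act_eq_self this)
  subst this
  exact h3.trans (B.toGauge_act _ _ _)

theorem exists_proj_eq (x : M) : ∃ p, B.proj p = x := by
  obtain ⟨e, hx, -⟩ := B.exists_trivialization x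
  exact ⟨_, e.proj_symm_apply' (x := (1 : G)) hx⟩

theorem toGauge_diag {p q : P} (h : B.proj p = B.proj q) : B.toGauge (p, p) = B.toGauge (q, q) := by
  obtain ⟨g, rfl⟩ := B.exists_act_eq h
  exact (B.toGauge_act _ _ _).symm

/-- The unit map `x ↦ \overline{(p, p)}`, where `π p = x`. -/
def gaugeUnit (x : M) : B.GaugeSpace :=
  B.toGauge ((B.exists_proj_eq x).choose, (B.exists_proj_eq x).choose)

theorem gaugeUnit_proj (p : P) : B.gaugeUnit (B.proj p) = B.toGauge (p, p) :=
  B.toGauge_diag (B.exists_proj_eq (B.proj p)).choose_spec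

/-- The inversion `\overline{(p, q)} ↦ \overline{(q, p)}`. -/
def gaugeInv : B.GaugeSpace → B.GaugeSpace :=
  Quotient.lift (fun z => B.toGauge (z.2, z.1))
    (by rintro z w ⟨g, rfl⟩; exact (B.toGauge_act _ _ _).symm)

@[simp] theorem gaugeInv_toGauge (p q : P) : B.gaugeInv (B.toGauge (p, q)) = B.toGauge (q, p) := rfl

/-- The gauge groupoid `𝒢(P) ⇉ M`. -/
def gaugeGroupoid : GroupoidStructure M B.GaugeSpace where
  src := B.src
  tgt := B.tgt
  mul := B.gaugeMul
  unit := B.gaugeUnit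
  inv := B.gaugeInv
  src_mul z w h := by
    obtain ⟨-, p, q, r, rfl, rfl, -⟩ := B.exists_mul z w h
    rw [B.gaugeMul_toGauge]; rfl
  tgt_mul z w h := by
    obtain ⟨-, p, q, r, rfl, rfl, -⟩ := B.exists_mul z w h
    rw [B.gaugeMul_toGauge]; rfl
  src_unit x := by
    obtain ⟨p, rfl⟩ := B.exists_proj_eq x
    rw [B.gaugeUnit_proj]; rfl
  tgt_unit x := by
    obtain ⟨p, rfl⟩ := B.exists_proj_eq x
    rw [B.gaugeUnit_proj]; rfl
  src_inv z := by obtain ⟨z, rfl⟩ := B.toGauge_surjective z; rfl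
  tgt_inv z := by obtain ⟨z, rfl⟩ := B.toGauge_surjective z; rfl
  mul_assoc z w v h₁ h₂ := by
    obtain ⟨-, p, q, r, rfl, rfl, -⟩ := B.exists_mul z w h₁
    obtain ⟨⟨r', s'⟩, rfl⟩ := B.toGauge_surjective v
    obtain ⟨g, rfl⟩ := B.exists_act_eq (p := r') (q := r) (by simpa using h₂.symm)
    simp only [← B.toGauge_act r' s' g, B.gaugeMul_toGauge]
  unit_mul z := by
    obtain ⟨⟨p, q⟩, rfl⟩ := B.toGauge_surjective z
    simp only [B.tgt_toGauge, B.gaugeUnit_proj, B.gaugeMul_toGauge]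
  mul_unit z := by
    obtain ⟨⟨p, q⟩, rfl⟩ := B.toGauge_surjective z
    simp only [B.src_toGauge, B.gaugeUnit_proj, B.gaugeMul_toGauge]
  inv_mul z := by
    obtain ⟨⟨p, q⟩, rfl⟩ := B.toGauge_surjective z
    simp only [B.src_toGauge, B.gaugeUnit_proj, B.gaugeMul_toGauge, B.gaugeInv_toGauge]
  mul_inv z := by
    obtain ⟨⟨p, q⟩, rfl⟩ := B.toGauge_surjective z
    simp only [B.tgt_toGauge, B.gaugeUnit_proj, B.gaugeMul_toGauge, B.gaugeInv_toGauge]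

end Algebra

/-! ### The smooth structure of the gauge groupoid -/

section Smooth

variable (B : PrincipalBundle IM IP IG M P G)

/-- The quotient topology. -/
instance : TopologicalSpace B.GaugeSpace :=
  inferInstanceAs (TopologicalSpace (Quotient B.diagonalSetoid))

theorem continuous_toGauge : Continuous B.toGauge := continuous_quotient_mk'

theorem continuous_act_right (g : G) : Continuous (fun p => B.act p g) :=
  B.contMDiff_act.continuous.comp (Continuous.prodMk_left g)

theorem isOpenQuotientMap_toGauge : IsOpenQuotientMap B.toGauge := by
  refine ⟨B.toGauge_surjective, B.continuous_toGauge, fun U hU => ?_⟩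
  change IsOpen (B.toGauge ⁻¹' (B.toGauge '' U))
  have : B.toGauge ⁻¹' (B.toGauge '' U) = ⋃ g : G, (fun z : P × P => (B.act z.1 g, B.act z.2 g)) ⁻¹' U := by
    ext z
    simp only [mem_preimage, mem_image, mem_iUnion]
    constructor
    · rintro ⟨w, hw, h⟩
      obtain ⟨g, rfl⟩ := B.toGauge_eq_iff.1 h.symm
      exact ⟨g, hw⟩
    · rintro ⟨g, hg⟩
      exact ⟨_, hg, B.toGauge_act _ _ _⟩
  rw [this]
  refine isOpen_iUnion fun g => hU.preimage ?_
  exact ((B.continuous_act_right g).comp continuous_fst).prodMk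
    ((B.continuous_act_right g).comp continuous_snd)

theorem continuous_src : Continuous B.src :=
  B.isOpenQuotientMap_toGauge.continuous_comp_iff.1
    (B.contMDiff_proj.continuous.comp continuous_snd)

theorem continuous_tgt : Continuous B.tgt :=
  B.isOpenQuotientMap_toGauge.continuous_comp_iff.1
    (B.contMDiff_proj.continuous.comp continuous_fst)

/-- A smooth equivariant local trivialization of the principal bundle. -/
structure LocalTriv extends Trivialization G B.proj where
  contMDiffOn_toFun : ContMDiffOn IP (IM.prod IG) ∞ toOpenPartialHomeomorph
    toOpenPartialHomeomorph.source
  contMDiffOn_symm : ContMDiffOn (IM.prod IG) IP ∞ toOpenPartialHomeomorph.symm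
    toOpenPartialHomeomorph.target
  map_act : ∀ p ∈ toOpenPartialHomeomorph.source, ∀ g,
    toOpenPartialHomeomorph (act B p g) = (proj B p, (toOpenPartialHomeomorph p).2 * g)

variable {B}

/-- The section `x ↦ e⁻¹(x, a)`. -/
def LocalTriv.sec (e : B.LocalTriv) (x : M) (a : G) : P := e.toOpenPartialHomeomorph.symm (x, a)

/-- The `G`-component of the trivialization. -/
def LocalTriv.fib (e : B.LocalTriv) (p : P) : G := (e.toOpenPartialHomeomorph p).2

theorem LocalTriv.fib_act (e : B.LocalTriv) {p : P} (hp : B.proj p ∈ e.baseSet) (g : G) :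
    e.fib (B.act p g) = e.fib p * g :=
  congrArg Prod.snd (e.map_act p (e.toTrivialization.mem_source.2 hp) g)

theorem LocalTriv.proj_sec (e : B.LocalTriv) {x : M} (hx : x ∈ e.baseSet) (a : G) :
    B.proj (e.sec x a) = x :=
  e.toTrivialization.proj_symm_apply' hx

theorem LocalTriv.fib_sec (e : B.LocalTriv) {x : M} (hx : x ∈ e.baseSet) (a : G) :
    e.fib (e.sec x a) = a :=
  congrArg Prod.snd (e.toTrivialization.apply_symm_apply' hx)

theorem LocalTriv.sec_fib (e : B.LocalTriv) {p : P} (hp : B.proj p ∈ e.baseSet) :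
    e.sec (B.proj p) (e.fib p) = p :=
  e.toTrivialization.symm_apply_mk_proj (e.toTrivialization.mem_source.2 hp)

theorem LocalTriv.sec_mul (e : B.LocalTriv) {x : M} (hx : x ∈ e.baseSet) (a g : G) :
    e.sec x (a * g) = B.act (e.sec x a) g := by
  have h1 : B.proj (B.act (e.sec x a) g) = x := by rw [B.proj_act, e.proj_sec hx]
  have h2 := e.sec_fib (p := B.act (e.sec x a) g) (by rwa [h1])
  rwa [h1, e.fib_act (by rwa [e.proj_sec hx]), e.fib_sec hx] at h2

theorem LocalTriv.contMDiffOn_sec (e : B.LocalTriv) :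
    ContMDiffOn (IM.prod IG) IP ∞ (fun z : M × G => e.sec z.1 z.2) (e.baseSet ×ˢ univ) := by
  have := e.contMDiffOn_symm
  rwa [e.target_eq] at this

theorem LocalTriv.contMDiffOn_fib (e : B.LocalTriv) :
    ContMDiffOn IP IG ∞ e.fib (B.proj ⁻¹' e.baseSet) := by
  have := e.contMDiffOn_toFun
  rw [e.source_eq] at this
  exact contMDiff_snd.comp_contMDiffOn this

variable (B) in
theorem exists_localTriv (x : M) : ∃ e : B.LocalTriv, x ∈ e.baseSet := by
  obtain ⟨e, hx, h1, h2, h3⟩ := B.exists_trivialization x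
  exact ⟨⟨e, h1, h2, h3⟩, hx⟩

/-- `\overline{(p, q)} ↦ ((π p, π q), e(p) f(q)⁻¹)`, see `chartFun_toGauge`. -/
def chartFun (e f : B.LocalTriv) (z : B.GaugeSpace) : (M × M) × G :=
  ((B.tgt z, B.src z), e.fib (Quotient.out z).1 * (f.fib (Quotient.out z).2)⁻¹)

theorem chartFun_toGauge (e f : B.LocalTriv) (p q : P) (hp : B.proj p ∈ e.baseSet)
    (hq : B.proj q ∈ f.baseSet) :
    chartFun e f (B.toGauge (p, q)) = ((B.proj p, B.proj q), e.fib p * (f.fib q)⁻¹) := by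
  have h : B.toGauge (p, q) = B.toGauge (Quotient.out (B.toGauge (p, q))) := (Quotient.out_eq _).symm
  obtain ⟨g, hg⟩ := B.toGauge_eq_iff.1 h
  simp only [chartFun, B.tgt_toGauge, B.src_toGauge, hg, e.fib_act hp, f.fib_act hq]
  simp

variable (B) in
/-- A local trivialization of `P` around `x`. -/
def trivAt (x : M) : B.LocalTriv := (B.exists_localTriv x).choose

theorem mem_baseSet_trivAt (x : M) : x ∈ (B.trivAt x).baseSet :=
  (B.exists_localTriv x).choose_spec

variable [LieGroup IG ∞ G]

/-- The local trivialization of `(tgt, src) : 𝒢(P) → M × M` with fibre `G` induced by local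
trivializations `e`, `f` of `P`; its inverse is `((x, y), a) ↦ \overline{(e⁻¹(x, a), f⁻¹(y, 1))}`. -/
def gaugeTriv (e f : B.LocalTriv) : OpenPartialHomeomorph B.GaugeSpace ((M × M) × G) where
  toFun := chartFun e f
  invFun w := B.toGauge (e.sec w.1.1 w.2, f.sec w.1.2 1)
  source := {z | B.tgt z ∈ e.baseSet ∧ B.src z ∈ f.baseSet}
  target := (e.baseSet ×ˢ f.baseSet) ×ˢ univ
  map_source' := by
    intro z hz
    exact ⟨hz, mem_univ _⟩
  map_target' := by
    rintro ⟨⟨x, y⟩, a⟩ ⟨⟨hx, hy⟩, -⟩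
    simp only [mem_ofPred_eq, tgt_toGauge, src_toGauge]
    exact ⟨by rwa [e.proj_sec hx], by rwa [f.proj_sec hy]⟩
  left_inv' := by
    intro z hz
    obtain ⟨⟨p, q⟩, rfl⟩ := B.toGauge_surjective z
    obtain ⟨hp, hq⟩ := hz
    rw [chartFun_toGauge e f p q hp hq]
    rw [← B.toGauge_act _ _ (f.fib q)]
    simp only [B.tgt_toGauge, B.src_toGauge] at hp hq
    rw [← e.sec_mul hp, ← f.sec_mul hq, inv_mul_cancel_right, one_mul, e.sec_fib hp, f.sec_fib hq]
  right_inv' := by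
    rintro ⟨⟨x, y⟩, a⟩ ⟨⟨hx, hy⟩, -⟩
    simp only at hx hy ⊢
    rw [chartFun_toGauge e f _ _ (by rwa [e.proj_sec hx]) (by rwa [f.proj_sec hy])]
    simp [e.proj_sec hx, f.proj_sec hy, e.fib_sec hx, f.fib_sec hy]
  open_source := (e.open_baseSet.preimage B.continuous_tgt).inter
    (f.open_baseSet.preimage B.continuous_src)
  open_target := (e.open_baseSet.prod f.open_baseSet).prod isOpen_univ
  continuousOn_toFun := by
    intro z hz
    obtain ⟨⟨p, q⟩, rfl⟩ := B.toGauge_surjective z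
    refine ContinuousAt.continuousWithinAt ?_
    rw [← B.isOpenQuotientMap_toGauge.continuousAt_comp_iff]
    obtain ⟨hp, hq⟩ := hz
    simp only [B.tgt_toGauge, B.src_toGauge] at hp hq
    have hπ := B.contMDiff_proj.continuous
    have hep : {p | B.proj p ∈ e.baseSet} ∈ 𝓝 p := (e.open_baseSet.preimage hπ).mem_nhds hp
    have hfq : {q | B.proj q ∈ f.baseSet} ∈ 𝓝 q := (f.open_baseSet.preimage hπ).mem_nhds hq
    have : (fun z : P × P => ((B.proj z.1, B.proj z.2), e.fib z.1 * (f.fib z.2)⁻¹))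
        =ᶠ[𝓝 (p, q)] chartFun e f ∘ B.toGauge := by
      filter_upwards [prod_mem_nhds hep hfq] with z hz
      exact (chartFun_toGauge e f z.1 z.2 hz.1 hz.2).symm
    refine ContinuousAt.congr ?_ this
    have : IsTopologicalGroup G := topologicalGroup_of_lieGroup IG ∞
    have h1 : ContinuousAt e.fib p := e.contMDiffOn_fib.continuousOn.continuousAt hep
    have h2 : ContinuousAt f.fib q := f.contMDiffOn_fib.continuousOn.continuousAt hfq
    exact ((hπ.comp continuous_fst).prodMk (hπ.comp continuous_snd)).continuousAt.prodMk
      ((h1.comp (x := (p, q)) continuousAt_fst).mul (h2.comp (x := (p, q)) continuousAt_snd).inv)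
  continuousOn_invFun := by
    refine B.continuous_toGauge.comp_continuousOn (ContinuousOn.prodMk ?_ ?_)
    · exact e.contMDiffOn_sec.continuousOn.comp
        (f := fun w : (M × M) × G => (w.1.1, w.2)) (by fun_prop) (fun w hw => ⟨hw.1.1, mem_univ _⟩)
    · exact f.contMDiffOn_sec.continuousOn.comp
        (f := fun w : (M × M) × G => (w.1.2, (1 : G))) (by fun_prop)
        (fun w hw => ⟨hw.1.2, mem_univ _⟩)

/-- `𝒢(P)` is locally homeomorphic to `M × M × G`, through the maps `gaugeTriv e f`. -/
instance : ChartedSpace ((M × M) × G) B.GaugeSpace where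
  atlas := {c | ∃ e f : B.LocalTriv, c = gaugeTriv e f}
  chartAt z := gaugeTriv (B.trivAt (B.tgt z)) (B.trivAt (B.src z))
  mem_chart_source _ := ⟨mem_baseSet_trivAt _, mem_baseSet_trivAt _⟩
  chart_mem_atlas _ := ⟨_, _, rfl⟩

/-- The manifold structure of `𝒢(P)`: the charts are the maps `gaugeTriv e f` followed by charts of
`M × M × G`. -/
instance : ChartedSpace (ModelProd (ModelProd HM HM) HG) B.GaugeSpace :=
  ChartedSpace.comp _ ((M × M) × G) _

theorem contMDiffOn_gaugeTriv_symm_trans (e f e' f' : B.LocalTriv) :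
    ContMDiffOn ((IM.prod IM).prod IG) ((IM.prod IM).prod IG) ∞
      ((gaugeTriv e f).symm ≫ₕ gaugeTriv e' f') ((gaugeTriv e f).symm ≫ₕ gaugeTriv e' f').source := by
  set S := ((gaugeTriv e f).symm ≫ₕ gaugeTriv e' f').source with hS
  have key : ∀ w ∈ S, w.1.1 ∈ e.baseSet ∧ w.1.2 ∈ f.baseSet ∧ w.1.1 ∈ e'.baseSet ∧
      w.1.2 ∈ f'.baseSet := by
    intro w hw
    rw [hS, OpenPartialHomeomorph.trans_source] at hw
    obtain ⟨⟨⟨hx, hy⟩, -⟩, h2⟩ := hw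
    have h2' : B.proj (e.sec w.1.1 w.2) ∈ e'.baseSet ∧ B.proj (f.sec w.1.2 1) ∈ f'.baseSet := h2
    rw [e.proj_sec hx, f.proj_sec hy] at h2'
    exact ⟨hx, hy, h2'⟩
  have hcongr : ∀ w ∈ S, ((gaugeTriv e f).symm ≫ₕ gaugeTriv e' f') w =
      (w.1, e'.fib (e.sec w.1.1 w.2) * (f'.fib (f.sec w.1.2 1))⁻¹) := by
    intro w hw
    obtain ⟨h1, h2, h3, h4⟩ := key w hw
    change chartFun e' f' (B.toGauge (e.sec w.1.1 w.2, f.sec w.1.2 1)) = _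
    rw [chartFun_toGauge e' f' _ _ (by rwa [e.proj_sec h1]) (by rwa [f.proj_sec h2]),
      e.proj_sec h1, f.proj_sec h2]
  refine ContMDiffOn.congr ?_ hcongr
  refine contMDiff_fst.contMDiffOn.prodMk (ContMDiffOn.mul ?_ (ContMDiffOn.inv ?_))
  · refine e'.contMDiffOn_fib.comp (e.contMDiffOn_sec.comp
      (f := fun w : (M × M) × G => (w.1.1, w.2)) ?_ ?_) ?_
    · exact ((contMDiff_fst.comp contMDiff_fst).prodMk contMDiff_snd).contMDiffOn
    · exact fun w hw => ⟨(key w hw).1, mem_univ _⟩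
    · intro w hw
      obtain ⟨h1, h2, h3, h4⟩ := key w hw
      change B.proj (e.sec w.1.1 w.2) ∈ e'.baseSet
      rwa [e.proj_sec h1]
  · refine f'.contMDiffOn_fib.comp (f.contMDiffOn_sec.comp
      (f := fun w : (M × M) × G => (w.1.2, (1 : G))) ?_ ?_) ?_
    · exact ((contMDiff_snd.comp contMDiff_fst).prodMk contMDiff_const).contMDiffOn
    · exact fun w hw => ⟨(key w hw).2.1, mem_univ _⟩
    · intro w hw
      obtain ⟨h1, h2, h3, h4⟩ := key w hw
      change B.proj (f.sec w.1.2 1) ∈ f'.baseSet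
      rwa [f.proj_sec h2]

instance [IsManifold IM ∞ M] : IsManifold ((IM.prod IM).prod IG) ∞ B.GaugeSpace := by
  have smooth : ∀ (e f e' f' : B.LocalTriv)
      (c c' : OpenPartialHomeomorph ((M × M) × G) (ModelProd (ModelProd HM HM) HG)),
      c ∈ atlas (ModelProd (ModelProd HM HM) HG) ((M × M) × G) →
      c' ∈ atlas (ModelProd (ModelProd HM HM) HG) ((M × M) × G) →
      ContMDiffOn ((IM.prod IM).prod IG) ((IM.prod IM).prod IG) ∞
        ((gaugeTriv e f ≫ₕ c).symm ≫ₕ (gaugeTriv e' f' ≫ₕ c'))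
        ((gaugeTriv e f ≫ₕ c).symm ≫ₕ (gaugeTriv e' f' ≫ₕ c')).source := by
    intro e f e' f' c c' hc hc'
    have h1 := contMDiffOn_of_mem_maximalAtlas (I := (IM.prod IM).prod IG) (n := ∞)
      (IsManifold.subset_maximalAtlas hc')
    have h2 := contMDiffOn_symm_of_mem_maximalAtlas (I := (IM.prod IM).prod IG) (n := ∞)
      (IsManifold.subset_maximalAtlas hc)
    have h3 := contMDiffOn_gaugeTriv_symm_trans e f e' f'
    refine (h1.comp (h3.comp (h2.mono ?_) ?_) ?_)
    · intro w hw
      simp only [mfld_simps] at hw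
      exact hw.1.1
    · intro w hw
      simp only [mfld_simps] at hw ⊢
      exact ⟨hw.1.2, hw.2.1⟩
    · intro w hw
      simp only [mfld_simps] at hw ⊢
      exact hw.2.2
  refine { compatible := ?_ }
  rintro _ _ ⟨_, ⟨e, f, rfl⟩, c, hc, rfl⟩ ⟨_, ⟨e', f', rfl⟩, c', hc', rfl⟩
  have hmem := (IsManifold.mem_maximalAtlas_iff_contMDiffOn (I := (IM.prod IM).prod IG) (n := ∞)
    ((gaugeTriv e f ≫ₕ c).symm ≫ₕ (gaugeTriv e' f' ≫ₕ c'))).2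
    ⟨smooth e f e' f' c c' hc hc', smooth e' f' e f c' c hc' hc⟩
  have := (mem_maximalAtlas_iff.1 hmem (OpenPartialHomeomorph.refl _) (by simp)).2
  simpa using this

end Smooth

/-! ### Principal connections and the vertical distribution -/

section Connection

variable (B : PrincipalBundle IM IP IG M P G)

/-- The value at `p` of the infinitesimal generator `u_P`, i.e. the derivative of `g ↦ p · g` at
`1` in the direction `u ∈ 𝔤 = T₁G`. -/
def generator (u : GroupLieAlgebra IG G) (p : P) : TangentSpace IP p :=
  (mfderiv IG IP (fun g : G => B.act p g) 1 : EG →L[ℝ] EP) u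

/-- The vertical bundle `V ⊆ TP`, with fibre `{u_P(p) | u ∈ 𝔤}` over `p`. -/
def verticalBundle : Set (TangentBundle IP P) :=
  {X | ∃ u : GroupLieAlgebra IG G, X.2 = B.generator u X.1}

variable (IG) in
/-- The adjoint action `Ad_g : 𝔤 → 𝔤`, the derivative of `h ↦ g h g⁻¹` at `1`. -/
def adjointAction (g : G) (u : GroupLieAlgebra IG G) : GroupLieAlgebra IG G :=
  (mfderiv IG IG (fun h : G => g * h * g⁻¹) 1 : EG →L[ℝ] EG) u

/-- A principal connection: a smooth `𝔤`-valued one-form `θ` on `P` with `θ(u_P) = u` and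
`ψ_g^* θ = Ad_{g⁻¹} θ`, where `ψ_g p = p · g`. -/
@[ext]
structure PrincipalConnection [IsManifold IP ∞ P] where
  toFun : ∀ p : P, TangentSpace IP p →L[ℝ] GroupLieAlgebra IG G
  contMDiff_toFun : ContMDiff (M' := EG) IP.tangent 𝓘(ℝ, EG) ∞
    (fun X : TangentBundle IP P => toFun X.1 X.2)
  map_generator : ∀ p u, toFun p (generator B u p) = u
  map_act : ∀ p g (X : TangentSpace IP p),
    toFun (act B p g) (mfderiv IP IP (fun q => act B q g) p X) = adjointAction IG g⁻¹ (toFun p X)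

variable {B} in
/-- The endomorphism `Θ(X) = (θ(X))_P` of `TP` associated with a connection `θ`. -/
def PrincipalConnection.verticalProjection [IsManifold IP ∞ P] (θ : B.PrincipalConnection)
    (X : TangentBundle IP P) : TangentBundle IP P :=
  ⟨X.1, B.generator (θ.toFun X.1 X.2) X.1⟩

variable [LieGroup IG ∞ G]

/-- The element `\overline{(X, Y)}` of `T𝒢(P)`: the image of `(X, Y) ∈ TP × TP` under the tangent
map of the quotient map `P × P → 𝒢(P)`. -/
def tangentToGauge (X Y : TangentBundle IP P) :
    TangentBundle ((IM.prod IM).prod IG) B.GaugeSpace :=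
  tangentMap (IP.prod IP) ((IM.prod IM).prod IG) B.toGauge ⟨(X.1, Y.1), (X.2, Y.2)⟩

/-- `Δ_V ⊆ T𝒢(P)`, the image of `V × V` under the quotient map `TP × TP → T𝒢(P)`. -/
def gaugeVertical : Set (TangentBundle ((IM.prod IM).prod IG) B.GaugeSpace) :=
  {W | ∃ X ∈ B.verticalBundle, ∃ Y ∈ B.verticalBundle, B.tangentToGauge X Y = W}

end Connection

end PrincipalBundle

end

/-!
The tangent bundle `TP → TM` is a principal bundle for the tangent group `TG`, and `T𝒢(P)` is the
quotient of `TP × TP` by the diagonal action of `TG`. The vertical projection `Θ` of a principal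
connection is `TG`-equivariant, so `Θ × Θ` descends to a form `K`; it is multiplicative because
the tangent product of `\overline{(X, Y)}` and `\overline{(Y, Z)}` is `\overline{(X, Z)}`.

Conversely, if the image of `K` is `Δ_V`, then `K\overline{(X, 0_p)} = \overline{(ΘX, 0_p)}` for
`X ∈ T_pP` and a unique vertical `ΘX`, and `Θ` is the projection of a connection since `K` is the
identity on `Δ_V`. Being linear, `K` fixes `\overline{(0_p, 0_q)}`, so multiplicativity applied to
`\overline{(X, 0_p)} · \overline{(0_p, 0_q)} = \overline{(X, 0_q)}` and then to
`\overline{(X, Y)} · \overline{(Y, 0_q)} = \overline{(X, 0_q)}` determines `K` from `Θ`.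
-/

noncomputable section

section TangentMap

variable {𝕜 : Type*} [NontriviallyNormedField 𝕜]
  {E : Type*} [NormedAddCommGroup E] [NormedSpace 𝕜 E]
  {H : Type*} [TopologicalSpace H] {I : ModelWithCorners 𝕜 E H}
  {N : Type*} [TopologicalSpace N] [ChartedSpace H N]
  {E' : Type*} [NormedAddCommGroup E'] [NormedSpace 𝕜 E']
  {H' : Type*} [TopologicalSpace H'] {I' : ModelWithCorners 𝕜 E' H'}
  {N' : Type*} [TopologicalSpace N'] [ChartedSpace H' N']
  {E'' : Type*} [NormedAddCommGroup E''] [NormedSpace 𝕜 E'']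
  {H'' : Type*} [TopologicalSpace H''] {I'' : ModelWithCorners 𝕜 E'' H''}
  {N'' : Type*} [TopologicalSpace N''] [ChartedSpace H'' N'']

/-- Tangent spaces at different points are the same model space, so that the vector parts can be
compared before the base points are identified. -/
theorem tangentBundle_ext {X Y : TangentBundle I N} (h : X.1 = Y.1) (h' : (X.2 : E) = Y.2) :
    X = Y := by
  obtain ⟨x, v⟩ := X
  obtain ⟨y, w⟩ := Y
  obtain rfl : x = y := h
  obtain rfl : v = w := h'
  rfl

theorem tangentMap_congr {f g : N → N'} {X : TangentBundle I N} (h : f =ᶠ[𝓝 X.1] g) :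
    tangentMap I I' f X = tangentMap I I' g X :=
  tangentBundle_ext h.eq_of_nhds <|
    congrArg (fun L : E →L[𝕜] E' => L X.2) (h.mfderiv_eq (I := I) (I' := I'))

theorem tangentMap_comp_of_eventuallyEq {g : N' → N''} {f : N → N'} {h : N → N''}
    {X : TangentBundle I N} (hg : MDifferentiableAt I' I'' g (f X.1))
    (hf : MDifferentiableAt I I' f X.1) (hh : ∀ᶠ x in 𝓝 X.1, h x = g (f x)) :
    tangentMap I I'' h X = tangentMap I' I'' g (tangentMap I I' f X) :=
  (tangentMap_congr hh).trans (tangentMap_comp_at X hg hf)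

theorem tangentMap_zero (f : N → N') (x : N) :
    tangentMap I I' f (⟨x, 0⟩ : TangentBundle I N) = ⟨f x, 0⟩ :=
  tangentBundle_ext rfl (map_zero (mfderiv I I' f x : E →L[𝕜] E'))

theorem tangentMap_const (y : N') (X : TangentBundle I N) :
    tangentMap I I' (fun _ => y) X = ⟨y, 0⟩ :=
  tangentBundle_ext rfl <|
    congrArg (fun L : E →L[𝕜] E' => L X.2) (mfderiv_const (I := I) (I' := I') (x := X.1))

/-- The pair `(X, Y) ∈ TN × TN'`, regarded as an element of `T(N × N')`. -/
def tangentPair (X : TangentBundle I N) (Y : TangentBundle I' N') :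
    TangentBundle (I.prod I') (N × N') :=
  (equivTangentBundleProd I N I' N').symm (X, Y)

theorem exists_tangentPair_eq (W : TangentBundle (I.prod I') (N × N')) :
    ∃ X Y, tangentPair X Y = W :=
  ⟨_, _, (equivTangentBundleProd I N I' N').symm_apply_apply W⟩

theorem tangentPair_inj {X X' : TangentBundle I N} {Y Y' : TangentBundle I' N'} :
    tangentPair X Y = tangentPair X' Y' ↔ X = X' ∧ Y = Y' :=
  (equivTangentBundleProd I N I' N').symm.injective.eq_iff.trans Prod.mk_inj

theorem tangentMap_fst_tangentPair (X : TangentBundle I N) (Y : TangentBundle I' N') :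
    tangentMap (I.prod I') I Prod.fst (tangentPair X Y) = X :=
  tangentMap_prodFst

theorem tangentMap_snd_tangentPair (X : TangentBundle I N) (Y : TangentBundle I' N') :
    tangentMap (I.prod I') I' Prod.snd (tangentPair X Y) = Y :=
  tangentMap_prodSnd

theorem tangentMap_comp_fst_tangentPair {f : N → N''} {X : TangentBundle I N}
    (hf : MDifferentiableAt I I'' f X.1) (Y : TangentBundle I' N') :
    tangentMap (I.prod I') I'' (fun z => f z.1) (tangentPair X Y) = tangentMap I I'' f X :=
  (tangentMap_comp_at (tangentPair X Y) hf mdifferentiableAt_fst).trans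
    (congrArg _ (tangentMap_fst_tangentPair X Y))

theorem tangentMap_comp_snd_tangentPair {f : N' → N''} {Y : TangentBundle I' N'}
    (hf : MDifferentiableAt I' I'' f Y.1) (X : TangentBundle I N) :
    tangentMap (I.prod I') I'' (fun z => f z.2) (tangentPair X Y) = tangentMap I' I'' f Y :=
  (tangentMap_comp_at (tangentPair X Y) hf mdifferentiableAt_snd).trans
    (congrArg _ (tangentMap_snd_tangentPair X Y))

theorem tangentMap_prodMk {f : N → N'} {g : N → N''} {X : TangentBundle I N}
    (hf : MDifferentiableAt I I' f X.1) (hg : MDifferentiableAt I I'' g X.1) :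
    tangentMap I (I'.prod I'') (fun x => (f x, g x)) X =
      tangentPair (tangentMap I I' f X) (tangentMap I I'' g X) :=
  tangentBundle_ext rfl <|
    congrArg (fun L : E →L[𝕜] E' × E'' => L X.2) (mfderiv_prodMk hf hg)

theorem tangentMap_tangentPair_zero_right {f : N × N' → N''} {X : TangentBundle I N} {y : N'}
    (hf : MDifferentiableAt (I.prod I') I'' f (X.1, y)) :
    tangentMap (I.prod I') I'' f (tangentPair X ⟨y, 0⟩) =
      tangentMap I I'' (fun x => f (x, y)) X :=
  (congrArg _ tangentMap_prod_left.symm).trans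
    (tangentMap_comp_at X hf (mdifferentiableAt_id.prodMk mdifferentiableAt_const)).symm

theorem tangentMap_tangentPair_zero_left {f : N × N' → N''} {x : N} {Y : TangentBundle I' N'}
    (hf : MDifferentiableAt (I.prod I') I'' f (x, Y.1)) :
    tangentMap (I.prod I') I'' f (tangentPair ⟨x, 0⟩ Y) =
      tangentMap I' I'' (fun y => f (x, y)) Y :=
  (congrArg _ tangentMap_prod_right.symm).trans
    (tangentMap_comp_at Y hf (mdifferentiableAt_const.prodMk mdifferentiableAt_id)).symm

theorem contMDiffOn_tangentMap [IsManifold I ∞ N] [IsManifold I' ∞ N'] {f : N → N'} {s : Set N}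
    (hf : ContMDiffOn I I' ∞ f s) (hs : IsOpen s) :
    ContMDiffOn I.tangent I'.tangent ∞ (tangentMap I I' f) (TotalSpace.proj ⁻¹' s) := by
  have : IsManifold I 1 N := .of_le (n := ∞) (by simp)
  have : IsManifold I' 1 N' := .of_le (n := ∞) (by simp)
  refine (hf.contMDiffOn_tangentMapWithin (m := ∞) (by simp) hs.uniqueMDiffOn).congr ?_
  intro X hX
  exact (tangentMapWithin_eq_tangentMap (hs.uniqueMDiffOn X.1 hX)
    ((hf.contMDiffAt (hs.mem_nhds hX)).mdifferentiableAt (by simp))).symm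

theorem contMDiffAt_tangentMap [IsManifold I ∞ N] [IsManifold I' ∞ N'] {f : N → N'} {s : Set N}
    (hf : ContMDiffOn I I' ∞ f s) (hs : IsOpen s) {X : TangentBundle I N} (hX : X.1 ∈ s) :
    ContMDiffAt I.tangent I'.tangent ∞ (tangentMap I I' f) X :=
  (contMDiffOn_tangentMap hf hs).contMDiffAt
    ((hs.preimage (FiberBundle.continuous_proj E (TangentSpace I))).mem_nhds hX)

theorem contMDiff_tangentMap [IsManifold I ∞ N] [IsManifold I' ∞ N'] {f : N → N'}
    (hf : ContMDiff I I' ∞ f) : ContMDiff I.tangent I'.tangent ∞ (tangentMap I I' f) :=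
  fun _ => contMDiffAt_tangentMap hf.contMDiffOn isOpen_univ (mem_univ _)

theorem contMDiff_tangentPair [IsManifold I ∞ N] [IsManifold I' ∞ N'] :
    ContMDiff (I.tangent.prod I'.tangent) (I.prod I').tangent ∞
      (fun Z : TangentBundle I N × TangentBundle I' N' => tangentPair Z.1 Z.2) := by
  have : IsManifold I 1 N := .of_le (n := ∞) (by simp)
  have : IsManifold I' 1 N' := .of_le (n := ∞) (by simp)
  exact contMDiff_equivTangentBundleProd_symm

theorem contMDiff_zeroVector [IsManifold I ∞ N] :
    ContMDiff I I.tangent ∞ (fun x => (⟨x, 0⟩ : TangentBundle I N)) :=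
  contMDiff_zeroSection 𝕜 (TangentSpace I)

theorem contMDiffAt_mk_const_iff [IsManifold I ∞ N] {x : N} {f : N'' → E} {y : N''} :
    ContMDiffAt I'' I.tangent ∞ (fun z => (⟨x, f z⟩ : TangentBundle I N)) y ↔
      ContMDiffAt I'' 𝓘(𝕜, E) ∞ f y := by
  have : IsManifold I 1 N := .of_le (n := ∞) (by simp)
  have h_coord : (fun z => (trivializationAt E (TangentSpace I) x
      (⟨x, f z⟩ : TangentBundle I N)).2) = f :=
    funext fun z => tangentCoordChange_self (mem_extChartAt_source (I := I) x)
  simp only [contMDiffAt_totalSpace, h_coord, contMDiffAt_const, true_and]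

end TangentMap

section LocalHomeomorph

variable {𝕜 : Type*} [NontriviallyNormedField 𝕜]
  {E : Type*} [NormedAddCommGroup E] [NormedSpace 𝕜 E]
  {H : Type*} [TopologicalSpace H] {I : ModelWithCorners 𝕜 E H} {n : ℕ∞ω}
  {N : Type*} [TopologicalSpace N] [ChartedSpace H N]
  {N' : Type*} [TopologicalSpace N'] [ChartedSpace H N'] [IsManifold I n N']
  {e : OpenPartialHomeomorph N N'}

theorem contMDiffOn_of_trans_chartAt_mem_maximalAtlas
    (he : ∀ y, e ≫ₕ chartAt H y ∈ IsManifold.maximalAtlas I n N) :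
    ContMDiffOn I I n e e.source := by
  intro x hx
  set c := chartAt H (e x)
  have h_source : x ∈ (e ≫ₕ c).source := ⟨hx, mem_chart_source H (e x)⟩
  have h_comp : ContMDiffAt I I n (fun y => c.symm ((e ≫ₕ c) y)) x :=
    (contMDiffAt_symm_of_mem_maximalAtlas (IsManifold.chart_mem_maximalAtlas (e x))
      (mem_chart_target H (e x))).comp x (contMDiffAt_of_mem_maximalAtlas (he _) h_source)
  refine (h_comp.congr_of_eventuallyEq ?_).contMDiffWithinAt
  filter_upwards [(e ≫ₕ c).open_source.mem_nhds h_source] with y hy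
  exact (c.left_inv hy.2).symm

theorem contMDiffOn_symm_of_trans_chartAt_mem_maximalAtlas
    (he : ∀ y, e ≫ₕ chartAt H y ∈ IsManifold.maximalAtlas I n N) :
    ContMDiffOn I I n e.symm e.target := by
  intro y hy
  set c := chartAt H y
  have h_target : c y ∈ (e ≫ₕ c).target :=
    ⟨mem_chart_target H y, by
      rw [mem_preimage]; exact (c.left_inv (mem_chart_source H y)).symm ▸ hy⟩
  have h_comp : ContMDiffAt I I n (fun w => (e ≫ₕ c).symm (c w)) y :=
    (contMDiffAt_symm_of_mem_maximalAtlas (he y) h_target).comp y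
      (contMDiffAt_of_mem_maximalAtlas (IsManifold.chart_mem_maximalAtlas y)
        (mem_chart_source H y))
  refine (h_comp.congr_of_eventuallyEq ?_).contMDiffWithinAt
  filter_upwards [c.open_source.mem_nhds (mem_chart_source H y)] with w hw
  exact congrArg e.symm (c.left_inv hw).symm

end LocalHomeomorph

section Velocity

variable {E : Type*} [NormedAddCommGroup E] [NormedSpace ℝ E]
  {H : Type*} [TopologicalSpace H] {I : ModelWithCorners ℝ E H}
  {N : Type*} [TopologicalSpace N] [ChartedSpace H N]
  {E' : Type*} [NormedAddCommGroup E'] [NormedSpace ℝ E']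
  {H' : Type*} [TopologicalSpace H'] {I' : ModelWithCorners ℝ E' H'}
  {N' : Type*} [TopologicalSpace N'] [ChartedSpace H' N']

theorem exists_contDiff_hasDerivAt_of_mem_nhds {s : Set E} {x : E} (hs : s ∈ 𝓝 x) (v : E) :
    ∃ σ : ℝ → E, ContDiff ℝ ∞ σ ∧ (∀ t, σ t ∈ s) ∧ σ 0 = x ∧ HasDerivAt σ v 0 := by
  obtain ⟨ε, hε, h_ball⟩ := Metric.mem_nhds_iff.1 hs
  set c : ℝ := ε / (‖v‖ + 1) with hc
  have hc_pos : 0 < c := by positivity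
  -- The sine keeps the curve inside the ball for all times.
  refine ⟨fun t => x + (c * Real.sin (t / c)) • v, ?_, fun t => h_ball ?_, by simp, ?_⟩
  · exact contDiff_const.add ((contDiff_const.mul
      (Real.contDiff_sin.comp (contDiff_id.div_const c))).smul contDiff_const)
  · rw [mem_ball_iff_norm, add_sub_cancel_left, norm_smul, norm_mul, Real.norm_of_nonneg hc_pos.le]
    calc c * ‖Real.sin (t / c)‖ * ‖v‖ ≤ c * 1 * ‖v‖ := by
          gcongr; exact Real.abs_sin_le_one _
      _ < c * (‖v‖ + 1) := by linarith
      _ = ε := by rw [hc]; field_simp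
  · have h_sin := (((hasDerivAt_id' (0 : ℝ)).div_const c).sin.const_mul c).smul_const v
    rw [zero_div, Real.cos_zero, one_mul, mul_one_div_cancel hc_pos.ne', one_smul] at h_sin
    exact h_sin.const_add x

theorem exists_contMDiff_velocity_eq [IsManifold I ∞ N] (X : TangentBundle I N)
    (hX : I.IsInteriorPoint X.1) :
    ∃ γ : ℝ → N, ContMDiff 𝓘(ℝ, ℝ) I ∞ γ ∧ velocity I γ = X := by
  have : IsManifold I 1 N := .of_le (n := ∞) (by simp)
  set φ := extChartAt I X.1
  have h_range : range I ∈ 𝓝 (φ X.1) := range_mem_nhds_isInteriorPoint hX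
  have h_target : interior φ.target ∈ 𝓝 (φ X.1) :=
    isOpen_interior.mem_nhds (I.isInteriorPoint_iff.1 hX)
  obtain ⟨σ, hσ, hσ_mem, hσ_zero, hσ_deriv⟩ := exists_contDiff_hasDerivAt_of_mem_nhds h_target X.2
  have h_symm : ∀ t, ContMDiffAt 𝓘(ℝ, E) I ∞ φ.symm (σ t) := fun t =>
    (contMDiffOn_extChartAt_symm X.1).contMDiffAt (mem_interior_iff_mem_nhds.1 (hσ_mem t))
  refine ⟨fun t => φ.symm (σ t), fun t => (h_symm t).comp t hσ.contMDiff.contMDiffAt, ?_⟩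
  have h_velocity : velocity 𝓘(ℝ, E) σ = ⟨φ X.1, X.2⟩ := by
    refine tangentBundle_ext hσ_zero ?_
    change mfderiv 𝓘(ℝ, ℝ) 𝓘(ℝ, E) σ 0 1 = X.2
    rw [mfderiv_eq_fderiv]
    exact hσ_deriv.deriv
  have h_deriv : mfderiv 𝓘(ℝ, E) I φ.symm (φ X.1) = ContinuousLinearMap.id ℝ E := by
    rw [← mfderivWithin_of_mem_nhds h_range]
    exact mfderivWithin_range_extChartAt_symm
  calc velocity I (fun t => φ.symm (σ t))
      = tangentMap 𝓘(ℝ, E) I φ.symm (velocity 𝓘(ℝ, E) σ) :=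
        tangentMap_comp_at _ ((h_symm 0).mdifferentiableAt (by simp))
          (hσ.contMDiff.mdifferentiable (by simp) _)
    _ = X := by
        rw [h_velocity]
        exact tangentBundle_ext (extChartAt_to_inv X.1)
          (congrArg (fun L : E →L[ℝ] E => L X.2) h_deriv)

end Velocity

namespace VectorValuedOneForm

variable {E : Type*} [NormedAddCommGroup E] [NormedSpace ℝ E]
  {H : Type*} [TopologicalSpace H] {I : ModelWithCorners ℝ E H}
  {N : Type*} [TopologicalSpace N] [ChartedSpace H N] [IsManifold I ∞ N]
  {E' : Type*} [NormedAddCommGroup E'] [NormedSpace ℝ E']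
  {H' : Type*} [TopologicalSpace H'] {I' : ModelWithCorners ℝ E' H'}
  {N' : Type*} [TopologicalSpace N'] [ChartedSpace H' N'] [IsManifold I' ∞ N']

theorem map_injective : Function.Injective (map : VectorValuedOneForm I N → _) := by
  intro K L h
  refine VectorValuedOneForm.ext (funext fun x => ContinuousLinearMap.ext fun v => ?_)
  simpa [map] using congrFun h ⟨x, v⟩

/-- The zero form on `N`. It is the base form `K_M` of every multiplicative form arising from a
connection. -/
instance : Zero (VectorValuedOneForm I N) where
  zero :=
    { toFun := fun _ => 0
      contMDiff_toFun := contMDiff_zeroVector.comp (contMDiff_proj (TangentSpace I)) }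

theorem map_mk_zero (K : VectorValuedOneForm I N) (x : N) : K.map ⟨x, 0⟩ = ⟨x, 0⟩ :=
  tangentBundle_ext rfl (_root_.map_zero (K.toFun x))

/-- The form `K × L` on `N × N'`, acting by `K` on `TN` and by `L` on `TN'`. -/
def prod (K : VectorValuedOneForm I N) (L : VectorValuedOneForm I' N') :
    VectorValuedOneForm (I.prod I') (N × N') where
  toFun z := (K.toFun z.1 : E →L[ℝ] E).prodMap (L.toFun z.2 : E' →L[ℝ] E')
  contMDiff_toFun := by
    have : IsManifold I 1 N := .of_le (n := ∞) (by simp)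
    have : IsManifold I' 1 N' := .of_le (n := ∞) (by simp)
    exact contMDiff_tangentPair.comp <|
      (K.contMDiff_toFun.prodMap L.contMDiff_toFun).comp contMDiff_equivTangentBundleProd

theorem prod_map_tangentPair (K : VectorValuedOneForm I N) (L : VectorValuedOneForm I' N')
    (X : TangentBundle I N) (Y : TangentBundle I' N') :
    (K.prod L).map (tangentPair X Y) = tangentPair (K.map X) (L.map Y) :=
  rfl

end VectorValuedOneForm

section LieGroup

variable {𝕜 : Type*} [NontriviallyNormedField 𝕜]
  {EG : Type*} [NormedAddCommGroup EG] [NormedSpace 𝕜 EG]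
  {HG : Type*} [TopologicalSpace HG] {IG : ModelWithCorners 𝕜 EG HG}
  {G : Type*} [TopologicalSpace G] [ChartedSpace HG G] [Group G]

/-- The multiplication of the tangent group `TG`. -/
def tangentMul (U V : TangentBundle IG G) : TangentBundle IG G :=
  tangentMap (IG.prod IG) IG (fun z : G × G => z.1 * z.2) (tangentPair U V)

variable {E : Type*} [NormedAddCommGroup E] [NormedSpace 𝕜 E]
  {H : Type*} [TopologicalSpace H] {I : ModelWithCorners 𝕜 E H}
  {N : Type*} [TopologicalSpace N] [ChartedSpace H N]
  [LieGroup IG 1 G]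

theorem tangentMul_tangentMap {f g : N → G} {X : TangentBundle I N}
    (hf : MDifferentiableAt I IG f X.1) (hg : MDifferentiableAt I IG g X.1) :
    tangentMul (tangentMap I IG f X) (tangentMap I IG g X) =
      tangentMap I IG (fun x => f x * g x) X := by
  rw [tangentMul, ← tangentMap_prodMk hf hg]
  exact (tangentMap_comp_at X ((contMDiff_mul IG 1).mdifferentiable one_ne_zero _)
    (hf.prodMk hg)).symm

theorem tangentMul_bijective (U : TangentBundle IG G) : Function.Bijective (tangentMul U) := by
  let div (z : G × G) : G := z.1⁻¹ * z.2
  have h_mul : MDifferentiable (IG.prod IG) IG (fun z : G × G => z.1 * z.2) :=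
    (contMDiff_mul IG 1).mdifferentiable one_ne_zero
  have h_div : MDifferentiable (IG.prod IG) IG div :=
    (contMDiff_fst.inv.mul contMDiff_snd).mdifferentiable one_ne_zero
  have mul_left_div (V) : tangentMul U (tangentMap (IG.prod IG) IG div (tangentPair U V)) = V :=
    calc
      _ = tangentMap (IG.prod IG) IG (fun z => z.1 * div z) (tangentPair U V) := by
        rw [← tangentMul_tangentMap mdifferentiableAt_fst (h_div _), tangentMap_fst_tangentPair]
      _ = V := by simpa only [div, mul_inv_cancel_left] using tangentMap_snd_tangentPair U V
  have left_div_mul (V) : tangentMap (IG.prod IG) IG div (tangentPair U (tangentMul U V)) = V :=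
    calc
      _ = tangentMap (IG.prod IG) IG div (tangentMap (IG.prod IG) (IG.prod IG)
          (fun z => (z.1, z.1 * z.2)) (tangentPair U V)) := by
        rw [tangentMap_prodMk mdifferentiableAt_fst (h_mul _), tangentMap_fst_tangentPair,
          tangentMul]
      _ = tangentMap (IG.prod IG) IG (fun z => div (z.1, z.1 * z.2)) (tangentPair U V) :=
        (tangentMap_comp_at _ (h_div _) (mdifferentiableAt_fst.prodMk (h_mul _))).symm
      _ = V := by simpa only [div, inv_mul_cancel_left] using tangentMap_snd_tangentPair U V
  exact ⟨Function.LeftInverse.injective (g := fun V => tangentMap (IG.prod IG) IG div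
    (tangentPair U V)) left_div_mul, fun V => ⟨_, mul_left_div V⟩⟩

end LieGroup

namespace PrincipalBundle

variable {EM : Type*} [NormedAddCommGroup EM] [NormedSpace ℝ EM]
  {HM : Type*} [TopologicalSpace HM] {IM : ModelWithCorners ℝ EM HM}
  {EP : Type*} [NormedAddCommGroup EP] [NormedSpace ℝ EP]
  {HP : Type*} [TopologicalSpace HP] {IP : ModelWithCorners ℝ EP HP}
  {EG : Type*} [NormedAddCommGroup EG] [NormedSpace ℝ EG]
  {HG : Type*} [TopologicalSpace HG] {IG : ModelWithCorners ℝ EG HG}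
  {M : Type*} [TopologicalSpace M] [ChartedSpace HM M]
  {P : Type*} [TopologicalSpace P] [ChartedSpace HP P]
  {G : Type*} [TopologicalSpace G] [ChartedSpace HG G] [Group G]
  {B : PrincipalBundle IM IP IG M P G}

section LocalTriv

theorem LocalTriv.isOpen_preimage_baseSet (e : B.LocalTriv) : IsOpen (B.proj ⁻¹' e.baseSet) :=
  e.open_baseSet.preimage B.contMDiff_proj.continuous

theorem LocalTriv.contMDiffAt_fib (e : B.LocalTriv) {p : P} (hp : B.proj p ∈ e.baseSet) :
    ContMDiffAt IP IG ∞ e.fib p :=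
  e.contMDiffOn_fib.contMDiffAt (e.isOpen_preimage_baseSet.mem_nhds hp)

theorem LocalTriv.contMDiffOn_sec_const (e : B.LocalTriv) (a : G) :
    ContMDiffOn IM IP ∞ (fun x => e.sec x a) e.baseSet :=
  e.contMDiffOn_sec.comp (contMDiff_id.prodMk contMDiff_const).contMDiffOn
    fun _ hx => ⟨hx, mem_univ _⟩

theorem LocalTriv.mdifferentiableAt_sec_const (e : B.LocalTriv) {x : M} (hx : x ∈ e.baseSet)
    (a : G) : MDifferentiableAt IM IP (fun y => e.sec y a) x :=
  ((e.contMDiffOn_sec_const a).contMDiffAt (e.open_baseSet.mem_nhds hx)).mdifferentiableAt (by simp)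

theorem LocalTriv.act_sec_fib (e : B.LocalTriv) {p : P} (hp : B.proj p ∈ e.baseSet) :
    B.act (e.sec (B.proj p) 1) (e.fib p) = p := by
  rw [← e.sec_mul hp, one_mul, e.sec_fib hp]

theorem LocalTriv.tangentMap_proj_tangentMap_sec (e : B.LocalTriv) {Z : TangentBundle IM M}
    (hZ : Z.1 ∈ e.baseSet) (a : G) :
    tangentMap IP IM B.proj (tangentMap IM IP (fun x => e.sec x a) Z) = Z := by
  rw [← tangentMap_comp_of_eventuallyEq (h := id)
    (B.contMDiff_proj.mdifferentiable (by simp) _) (e.mdifferentiableAt_sec_const hZ a),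
    tangentMap_id, id]
  filter_upwards [e.open_baseSet.mem_nhds hZ] with x hx
  exact (e.proj_sec hx a).symm

end LocalTriv

section TangentAct

variable (B)

theorem tangentMap_proj_surjective : Function.Surjective (tangentMap IP IM B.proj) := fun Z =>
  ⟨_, (B.trivAt Z.1).tangentMap_proj_tangentMap_sec (mem_baseSet_trivAt Z.1) 1⟩

/-- The right action of the tangent group `TG` on `TP`, the tangent map of the action of `G` on
`P`. It makes `TP → TM` a principal `TG`-bundle. -/
def tangentAct (X : TangentBundle IP P) (U : TangentBundle IG G) : TangentBundle IP P :=
  tangentMap (IP.prod IG) IP (fun z : P × G => B.act z.1 z.2) (tangentPair X U)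

theorem mdifferentiable_act :
    MDifferentiable (IP.prod IG) IP (fun z : P × G => B.act z.1 z.2) :=
  B.contMDiff_act.mdifferentiable (by simp)

theorem tangentAct_tangentMap {E : Type*} [NormedAddCommGroup E] [NormedSpace ℝ E]
    {H : Type*} [TopologicalSpace H] {I : ModelWithCorners ℝ E H}
    {N : Type*} [TopologicalSpace N] [ChartedSpace H N] {f : N → P} {g : N → G}
    {Z : TangentBundle I N} (hf : MDifferentiableAt I IP f Z.1)
    (hg : MDifferentiableAt I IG g Z.1) :
    B.tangentAct (tangentMap I IP f Z) (tangentMap I IG g Z) =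
      tangentMap I IP (fun x => B.act (f x) (g x)) Z := by
  rw [tangentAct, ← tangentMap_prodMk hf hg]
  exact (tangentMap_comp_at Z (B.mdifferentiable_act _) (hf.prodMk hg)).symm

theorem tangentAct_zero_right (X : TangentBundle IP P) (g : G) :
    B.tangentAct X ⟨g, 0⟩ = tangentMap IP IP (fun p => B.act p g) X :=
  tangentMap_tangentPair_zero_right (B.mdifferentiable_act _)

theorem tangentAct_zero_left (p : P) (U : TangentBundle IG G) :
    B.tangentAct ⟨p, 0⟩ U = tangentMap IG IP (fun g => B.act p g) U :=
  tangentMap_tangentPair_zero_left (B.mdifferentiable_act _)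

theorem tangentAct_zero_zero (p : P) (g : G) : B.tangentAct ⟨p, 0⟩ ⟨g, 0⟩ = ⟨B.act p g, 0⟩ := by
  rw [tangentAct_zero_right, tangentMap_zero]

theorem tangentAct_zero_one (p : P) (u : GroupLieAlgebra IG G) :
    B.tangentAct ⟨p, 0⟩ ⟨1, u⟩ = ⟨p, B.generator u p⟩ := by
  rw [tangentAct_zero_left]
  exact tangentBundle_ext (B.act_one p) rfl

theorem tangentAct_one_zero (X : TangentBundle IP P) : B.tangentAct X ⟨1, 0⟩ = X := by
  rw [tangentAct_zero_right, funext B.act_one]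
  exact congrFun tangentMap_id X

theorem tangentAct_one (X : TangentBundle IP P) (u : GroupLieAlgebra IG G) :
    B.tangentAct X ⟨1, u⟩ = ⟨X.1, X.2 + B.generator u X.1⟩ := by
  refine tangentBundle_ext (B.act_one X.1) ?_
  have h_left : mfderiv IP IP (fun p => B.act p 1) X.1 = ContinuousLinearMap.id ℝ EP := by
    rw [funext B.act_one]
    exact mfderiv_id
  refine (mfderiv_prod_eq_add_apply (B.mdifferentiable_act (X.1, 1))).trans ?_
  let v : EP := B.generator u X.1
  exact congrArg (fun L : EP →L[ℝ] EP => L X.2 + v) h_left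

theorem tangentMap_proj_tangentAct (X : TangentBundle IP P) (U : TangentBundle IG G) :
    tangentMap IP IM B.proj (B.tangentAct X U) = tangentMap IP IM B.proj X := by
  have h_proj := B.contMDiff_proj.mdifferentiable (by simp)
  rw [tangentAct, ← tangentMap_comp_of_eventuallyEq (h_proj _) (B.mdifferentiable_act _)
    (.of_forall fun z => (B.proj_act z.1 z.2).symm),
    tangentMap_comp_of_eventuallyEq (h_proj _) mdifferentiableAt_fst (.of_forall fun _ => rfl),
    tangentMap_fst_tangentPair]

theorem LocalTriv.tangentAct_tangentMap_sec_fib {B : PrincipalBundle IM IP IG M P G}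
    (e : B.LocalTriv) {X : TangentBundle IP P} (hX : B.proj X.1 ∈ e.baseSet) :
    B.tangentAct (tangentMap IM IP (fun x => e.sec x 1) (tangentMap IP IM B.proj X))
      (tangentMap IP IG e.fib X) = X := by
  have h_proj := B.contMDiff_proj.mdifferentiable (by simp) X.1
  have h_sec := e.mdifferentiableAt_sec_const hX 1
  calc
    _ = tangentMap IP IP (fun p => B.act (e.sec (B.proj p) 1) (e.fib p)) X := by
      rw [← tangentMap_comp_at X h_sec h_proj]
      exact B.tangentAct_tangentMap (h_sec.comp X.1 h_proj)
        ((e.contMDiffAt_fib hX).mdifferentiableAt (by simp))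
    _ = tangentMap IP IP id X := tangentMap_congr <| by
      filter_upwards [e.isOpen_preimage_baseSet.mem_nhds hX] with p hp using e.act_sec_fib hp
    _ = X := congrFun tangentMap_id X

variable [LieGroup IG ∞ G]

theorem tangentAct_tangentAct (X : TangentBundle IP P) (U V : TangentBundle IG G) :
    B.tangentAct (B.tangentAct X U) V = B.tangentAct X (tangentMul U V) := by
  have : LieGroup IG 1 G := .of_le (n := ∞) (by simp)
  set W := tangentPair (tangentPair X U) V
  have h_point : MDifferentiableAt ((IP.prod IG).prod IG) IP (fun z => z.1.1) W.1 :=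
    mdifferentiableAt_fst.comp W.1 mdifferentiableAt_fst
  have h_left : MDifferentiableAt ((IP.prod IG).prod IG) IG (fun z => z.1.2) W.1 :=
    mdifferentiableAt_snd.comp W.1 mdifferentiableAt_fst
  have hX : tangentMap _ IP (fun z => z.1.1) W = X :=
    (tangentMap_comp_fst_tangentPair mdifferentiableAt_fst V).trans (tangentMap_fst_tangentPair X U)
  have hU : tangentMap _ IG (fun z => z.1.2) W = U :=
    (tangentMap_comp_fst_tangentPair mdifferentiableAt_snd V).trans (tangentMap_snd_tangentPair X U)
  have hV : tangentMap _ IG Prod.snd W = V := tangentMap_snd_tangentPair _ V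
  have h_act : MDifferentiableAt ((IP.prod IG).prod IG) IP (fun z => B.act z.1.1 z.1.2) W.1 :=
    (B.mdifferentiable_act (X.1, U.1)).comp W.1 (h_point.prodMk h_left)
  have h_mul : MDifferentiableAt ((IP.prod IG).prod IG) IG (fun z => z.1.2 * z.2) W.1 :=
    ((contMDiff_mul IG 1).mdifferentiable one_ne_zero (U.1, V.1)).comp W.1
      (h_left.prodMk mdifferentiableAt_snd)
  rw [← hX, ← hU, ← hV, B.tangentAct_tangentMap h_point h_left,
    B.tangentAct_tangentMap h_act mdifferentiableAt_snd,
    tangentMul_tangentMap h_left mdifferentiableAt_snd, B.tangentAct_tangentMap h_point h_mul]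
  simp only [B.act_mul]

theorem tangentMap_proj_eq_iff {X Y : TangentBundle IP P} :
    tangentMap IP IM B.proj X = tangentMap IP IM B.proj Y ↔ ∃ U, Y = B.tangentAct X U := by
  constructor
  · intro h
    set e := B.trivAt (B.proj X.1)
    have hX : B.proj X.1 ∈ e.baseSet := mem_baseSet_trivAt _
    have h_base : B.proj X.1 = B.proj Y.1 := congrArg TotalSpace.proj h
    have hY : B.proj Y.1 ∈ e.baseSet := h_base ▸ hX
    have : LieGroup IG 1 G := .of_le (n := ∞) (by simp)
    obtain ⟨U, hU⟩ := (tangentMul_bijective (tangentMap IP IG e.fib X)).2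
      (tangentMap IP IG e.fib Y)
    refine ⟨U, ?_⟩
    rw [← e.tangentAct_tangentMap_sec_fib hY, ← hU, ← h, ← tangentAct_tangentAct,
      e.tangentAct_tangentMap_sec_fib hX]
  · rintro ⟨U, rfl⟩
    exact (B.tangentMap_proj_tangentAct X U).symm

theorem tangentAct_left_injective (X : TangentBundle IP P) :
    Function.Injective (B.tangentAct X) := by
  set e := B.trivAt (B.proj X.1)
  have hX : B.proj X.1 ∈ e.baseSet := mem_baseSet_trivAt _
  have : LieGroup IG 1 G := .of_le (n := ∞) (by simp)
  have h_mdiff := (e.contMDiffAt_fib hX).mdifferentiableAt (by simp)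
  have h_fib (U : TangentBundle IG G) : tangentMap IP IG e.fib (B.tangentAct X U) =
      tangentMul (tangentMap IP IG e.fib X) U := by
    have hXU : B.proj (B.act X.1 U.1) ∈ e.baseSet := (B.proj_act _ _).symm ▸ hX
    have h_fst : MDifferentiableAt (IP.prod IG) IG (fun z => e.fib z.1) (tangentPair X U).1 :=
      MDifferentiableAt.comp (g := e.fib) (X.1, U.1) h_mdiff mdifferentiableAt_fst
    calc
      _ = tangentMap (IP.prod IG) IG (fun z : P × G => e.fib z.1 * z.2) (tangentPair X U) := by
        refine (tangentMap_comp_of_eventuallyEq (f := fun z : P × G => B.act z.1 z.2)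
          ((e.contMDiffAt_fib hXU).mdifferentiableAt (by simp)) (B.mdifferentiable_act _) ?_).symm
        filter_upwards [continuousAt_fst.preimage_mem_nhds
          (e.isOpen_preimage_baseSet.mem_nhds hX)] with z hz using (e.fib_act hz z.2).symm
      _ = _ := by
        rw [← tangentMul_tangentMap h_fst mdifferentiableAt_snd, tangentMap_snd_tangentPair,
          tangentMap_comp_fst_tangentPair h_mdiff U]
  exact fun U V h => (tangentMul_bijective (tangentMap IP IG e.fib X)).1 <| by
    rw [← h_fib, ← h_fib, h]

theorem mem_verticalBundle_iff {X : TangentBundle IP P} :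
    X ∈ B.verticalBundle ↔ tangentMap IP IM B.proj X = ⟨B.proj X.1, 0⟩ := by
  rw [← tangentMap_zero (I := IP), eq_comm, tangentMap_proj_eq_iff]
  constructor
  · rintro ⟨u, hu⟩
    exact ⟨⟨1, u⟩, Eq.trans (b := ⟨X.1, B.generator u X.1⟩) (tangentBundle_ext rfl hu)
      (B.tangentAct_zero_one X.1 u).symm⟩
  · rintro ⟨⟨g, u⟩, h⟩
    obtain rfl : g = 1 := B.act_eq_self (congrArg TotalSpace.proj h).symm
    rw [tangentAct_zero_one] at h
    rw [h]
    exact ⟨u, rfl⟩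

end TangentAct

section Descent

variable [LieGroup IG ∞ G] [IsManifold IM ∞ M] [IsManifold IP ∞ P] (B)

theorem exists_map_tangentMap_proj_eq (L : VectorValuedOneForm IP P)
    (hL : ∀ X U, tangentMap IP IM B.proj (L.map (B.tangentAct X U)) =
      tangentMap IP IM B.proj (L.map X)) :
    ∃ K : VectorValuedOneForm IM M,
      ∀ X, K.map (tangentMap IP IM B.proj X) = tangentMap IP IM B.proj (L.map X) := by
  let toFun (x : M) : EM →L[ℝ] EM :=
    (mfderiv IP IM B.proj ((B.trivAt x).sec x 1) : EP →L[ℝ] EM) ∘L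
      (L.toFun ((B.trivAt x).sec x 1) : EP →L[ℝ] EP) ∘L
      (mfderiv IM IP (fun y => (B.trivAt x).sec y 1) x : EM →L[ℝ] EP)
  have h_lift {X : TangentBundle IP P} {Z : TangentBundle IM M}
      (h : tangentMap IP IM B.proj X = Z) :
      ⟨Z.1, toFun Z.1 Z.2⟩ = tangentMap IP IM B.proj (L.map X) := by
    subst h
    set e := B.trivAt (B.proj X.1)
    have hX : B.proj X.1 ∈ e.baseSet := mem_baseSet_trivAt _
    obtain ⟨U, hU⟩ := B.tangentMap_proj_eq_iff.1
      (e.tangentMap_proj_tangentMap_sec (Z := tangentMap IP IM B.proj X) hX 1).symm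
    rw [← hL X U, ← hU]
    exact tangentBundle_ext (e.proj_sec hX 1).symm rfl
  refine ⟨⟨toFun, fun Z => ?_⟩, fun X => h_lift rfl⟩
  set e := B.trivAt Z.1
  have hZ : Z.1 ∈ e.baseSet := mem_baseSet_trivAt _
  have h_smooth : ContMDiffAt IM.tangent IM.tangent ∞ (fun Z' => tangentMap IP IM B.proj
      (L.map (tangentMap IM IP (fun x => e.sec x 1) Z'))) Z :=
    (contMDiff_tangentMap B.contMDiff_proj).contMDiffAt.comp Z <|
      L.contMDiff_toFun.contMDiffAt.comp Z <|
        contMDiffAt_tangentMap (e.contMDiffOn_sec_const 1) e.open_baseSet hZ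
  refine h_smooth.congr_of_eventuallyEq ?_
  filter_upwards [(e.open_baseSet.preimage
    (FiberBundle.continuous_proj EM (TangentSpace IM))).mem_nhds hZ] with Z' hZ'
  exact h_lift (e.tangentMap_proj_tangentMap_sec hZ' 1)

end Descent

section GaugeSpace

variable [LieGroup IG ∞ G]

theorem gaugeTriv_toGauge (e f : B.LocalTriv) {p q : P} (hp : B.proj p ∈ e.baseSet)
    (hq : B.proj q ∈ f.baseSet) : gaugeTriv e f (B.toGauge (p, q)) =
      ((B.proj p, B.proj q), e.fib p * (f.fib q)⁻¹) :=
  chartFun_toGauge e f p q hp hq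

theorem gaugeTriv_symm_mk (e f : B.LocalTriv) {p q : P} (hp : B.proj p ∈ e.baseSet)
    (hq : B.proj q ∈ f.baseSet) : (gaugeTriv e f).symm
      ((B.proj p, B.proj q), e.fib p * (f.fib q)⁻¹) = B.toGauge (p, q) := by
  rw [← gaugeTriv_toGauge e f hp hq]
  exact (gaugeTriv e f).left_inv ⟨hp, hq⟩

theorem mem_gaugeTriv_trivAt_source (z : B.GaugeSpace) :
    z ∈ (gaugeTriv (B.trivAt (B.tgt z)) (B.trivAt (B.src z))).source :=
  ⟨mem_baseSet_trivAt _, mem_baseSet_trivAt _⟩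

variable [IsManifold IM ∞ M]

theorem gaugeTriv_trans_chartAt_mem_maximalAtlas (e f : B.LocalTriv) (w : (M × M) × G) :
    gaugeTriv e f ≫ₕ chartAt (ModelProd (ModelProd HM HM) HG) w ∈
      IsManifold.maximalAtlas ((IM.prod IM).prod IG) ∞ B.GaugeSpace :=
  IsManifold.subset_maximalAtlas ⟨_, ⟨e, f, rfl⟩, _, chart_mem_atlas _ w, rfl⟩

theorem contMDiffOn_gaugeTriv (e f : B.LocalTriv) :
    ContMDiffOn ((IM.prod IM).prod IG) ((IM.prod IM).prod IG) ∞ (gaugeTriv e f)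
      (gaugeTriv e f).source := by
  have : IsManifold IG ∞ G := ContMDiffMul.toIsManifold
  exact contMDiffOn_of_trans_chartAt_mem_maximalAtlas (gaugeTriv_trans_chartAt_mem_maximalAtlas e f)

theorem contMDiffOn_gaugeTriv_symm (e f : B.LocalTriv) :
    ContMDiffOn ((IM.prod IM).prod IG) ((IM.prod IM).prod IG) ∞ (gaugeTriv e f).symm
      (gaugeTriv e f).target := by
  have : IsManifold IG ∞ G := ContMDiffMul.toIsManifold
  exact contMDiffOn_symm_of_trans_chartAt_mem_maximalAtlas
    (gaugeTriv_trans_chartAt_mem_maximalAtlas e f)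

variable (B)

theorem contMDiff_tgt : ContMDiff ((IM.prod IM).prod IG) IM ∞ B.tgt := fun z =>
  (contMDiff_fst.comp contMDiff_fst).contMDiffAt.comp z <|
    (contMDiffOn_gaugeTriv _ _).contMDiffAt <|
      (gaugeTriv _ _).open_source.mem_nhds (mem_gaugeTriv_trivAt_source z)

theorem contMDiff_src : ContMDiff ((IM.prod IM).prod IG) IM ∞ B.src := fun z =>
  (contMDiff_snd.comp contMDiff_fst).contMDiffAt.comp z <|
    (contMDiffOn_gaugeTriv _ _).contMDiffAt <|
      (gaugeTriv _ _).open_source.mem_nhds (mem_gaugeTriv_trivAt_source z)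

theorem contMDiff_toGauge :
    ContMDiff (IP.prod IP) ((IM.prod IM).prod IG) ∞ B.toGauge := by
  rintro ⟨p, q⟩
  set e := B.trivAt (B.proj p)
  set f := B.trivAt (B.proj q)
  have hp : B.proj p ∈ e.baseSet := mem_baseSet_trivAt _
  have hq : B.proj q ∈ f.baseSet := mem_baseSet_trivAt _
  have h_proj : ContMDiff IP IM ∞ B.proj := B.contMDiff_proj
  have h_coord : ContMDiffAt (IP.prod IP) ((IM.prod IM).prod IG) ∞ (fun z : P × P =>
      ((B.proj z.1, B.proj z.2), e.fib z.1 * (f.fib z.2)⁻¹)) (p, q) :=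
    ((h_proj.comp contMDiff_fst).prodMk (h_proj.comp contMDiff_snd)).contMDiffAt.prodMk <|
      ((e.contMDiffAt_fib hp).comp (p, q) contMDiffAt_fst).mul
        ((f.contMDiffAt_fib hq).comp (p, q) contMDiffAt_snd).inv
  have h_symm := (contMDiffOn_gaugeTriv_symm e f).contMDiffAt
    ((gaugeTriv e f).open_target.mem_nhds (x := ((B.proj p, B.proj q), e.fib p * (f.fib q)⁻¹))
      ⟨⟨hp, hq⟩, mem_univ _⟩)
  refine (h_symm.comp (p, q) h_coord).congr_of_eventuallyEq ?_
  filter_upwards [prod_mem_nhds (e.isOpen_preimage_baseSet.mem_nhds hp)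
    (f.isOpen_preimage_baseSet.mem_nhds hq)] with z hz
  exact (gaugeTriv_symm_mk e f hz.1 hz.2).symm

end GaugeSpace

section PairBundle

variable [LieGroup IG ∞ G] [IsManifold IM ∞ M]

theorem contMDiffOn_toGauge_fib (f : B.LocalTriv) :
    ContMDiffOn (IP.prod IP) (((IM.prod IM).prod IG).prod IG) ∞
      (fun z : P × P => (B.toGauge z, f.fib z.2)) {z | B.proj z.2 ∈ f.baseSet} :=
  B.contMDiff_toGauge.contMDiffOn.prodMk <|
    f.contMDiffOn_fib.comp contMDiff_snd.contMDiffOn fun _ hz => hz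

theorem contMDiffOn_sec_sec (e f : B.LocalTriv) :
    ContMDiffOn (((IM.prod IM).prod IG).prod IG) (IP.prod IP) ∞
      (fun w : B.GaugeSpace × G =>
        (e.sec (B.tgt w.1) ((gaugeTriv e f w.1).2 * w.2), f.sec (B.src w.1) w.2))
      ((gaugeTriv e f).source ×ˢ univ) := by
  have h_coord : ContMDiffOn (((IM.prod IM).prod IG).prod IG) IG ∞
      (fun w : B.GaugeSpace × G => (gaugeTriv e f w.1).2) ((gaugeTriv e f).source ×ˢ univ) :=
    contMDiff_snd.comp_contMDiffOn <|
      (contMDiffOn_gaugeTriv e f).comp contMDiff_fst.contMDiffOn fun _ hw => hw.1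
  have h_tgt : ContMDiff (((IM.prod IM).prod IG).prod IG) IM ∞
      (fun w : B.GaugeSpace × G => B.tgt w.1) := B.contMDiff_tgt.comp contMDiff_fst
  have h_src : ContMDiff (((IM.prod IM).prod IG).prod IG) IM ∞
      (fun w : B.GaugeSpace × G => B.src w.1) := B.contMDiff_src.comp contMDiff_fst
  exact (e.contMDiffOn_sec.comp
      (h_tgt.contMDiffOn.prodMk (h_coord.mul contMDiff_snd.contMDiffOn))
      fun _ hw => ⟨hw.1.1, mem_univ _⟩).prodMk
    (f.contMDiffOn_sec.comp (h_src.contMDiffOn.prodMk contMDiff_snd.contMDiffOn)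
      fun _ hw => ⟨hw.1.2, mem_univ _⟩)

/-- The local trivialization of `P × P → 𝒢(P)` induced by local trivializations `e`, `f` of `P`.
Its `G`-component is that of `f` at the second point. -/
def pairTriv (e f : B.LocalTriv) : Trivialization G B.toGauge where
  toFun z := (B.toGauge z, f.fib z.2)
  invFun w := (e.sec (B.tgt w.1) ((gaugeTriv e f w.1).2 * w.2), f.sec (B.src w.1) w.2)
  source := B.toGauge ⁻¹' (gaugeTriv e f).source
  target := (gaugeTriv e f).source ×ˢ univ
  baseSet := (gaugeTriv e f).source
  open_baseSet := (gaugeTriv e f).open_source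
  open_source := (gaugeTriv e f).open_source.preimage B.continuous_toGauge
  open_target := (gaugeTriv e f).open_source.prod isOpen_univ
  source_eq := rfl
  target_eq := rfl
  proj_toFun _ _ := rfl
  map_source' _ hz := ⟨hz, mem_univ _⟩
  map_target' w hw := by
    refine ⟨?_, ?_⟩
    · simpa only [tgt_toGauge, e.proj_sec hw.1.1] using hw.1.1
    · simpa only [src_toGauge, f.proj_sec hw.1.2] using hw.1.2
  left_inv' := by
    rintro ⟨p, q⟩ ⟨hp, hq⟩
    simp only [tgt_toGauge, src_toGauge, gaugeTriv_toGauge e f hp hq, inv_mul_cancel_right,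
      e.sec_fib hp, f.sec_fib hq]
  right_inv' := by
    rintro ⟨z, g⟩ ⟨hz, -⟩
    refine Prod.ext ?_ (f.fib_sec hz.2 g)
    simp only [e.sec_mul hz.1]
    rw [← one_mul g, f.sec_mul hz.2, one_mul, toGauge_act]
    exact (gaugeTriv e f).left_inv hz
  continuousOn_toFun := (contMDiffOn_toGauge_fib f).continuousOn.mono fun _ hz => hz.2
  continuousOn_invFun := (contMDiffOn_sec_sec e f).continuousOn

variable (B)

/-- The principal `G`-bundle `P × P → 𝒢(P)`, with `G` acting diagonally. -/
def pairBundle :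
    PrincipalBundle ((IM.prod IM).prod IG) (IP.prod IP) IG B.GaugeSpace (P × P) G where
  proj := B.toGauge
  act z g := (B.act z.1 g, B.act z.2 g)
  act_one z := by simp only [B.act_one]
  act_mul z g h := by simp only [B.act_mul]
  contMDiff_act :=
    (B.contMDiff_act.comp ((contMDiff_fst.comp contMDiff_fst).prodMk contMDiff_snd)).prodMk
      (B.contMDiff_act.comp ((contMDiff_snd.comp contMDiff_fst).prodMk contMDiff_snd))
  contMDiff_proj := B.contMDiff_toGauge
  proj_act z g := B.toGauge_act z.1 z.2 g
  exists_trivialization z := by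
    let e := B.trivAt (B.tgt z)
    let f := B.trivAt (B.src z)
    refine ⟨pairTriv e f, mem_gaugeTriv_trivAt_source z,
      (contMDiffOn_toGauge_fib f).mono fun _ hz => hz.2, contMDiffOn_sec_sec e f, ?_⟩
    rintro ⟨p, q⟩ hpq g
    exact Prod.ext (B.toGauge_act p q g) (f.fib_act hpq.2 g)

theorem pairBundle_tangentAct_tangentPair (X Y : TangentBundle IP P) (U : TangentBundle IG G) :
    B.pairBundle.tangentAct (tangentPair X Y) U =
      tangentPair (B.tangentAct X U) (B.tangentAct Y U) := by
  set W := tangentPair (tangentPair X Y) U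
  have h_fst : MDifferentiableAt ((IP.prod IP).prod IG) IP (fun z => z.1.1) W.1 :=
    mdifferentiableAt_fst.comp W.1 mdifferentiableAt_fst
  have h_snd : MDifferentiableAt ((IP.prod IP).prod IG) IP (fun z => z.1.2) W.1 :=
    mdifferentiableAt_snd.comp W.1 mdifferentiableAt_fst
  have hX : tangentMap _ IP (fun z => z.1.1) W = X :=
    (tangentMap_comp_fst_tangentPair mdifferentiableAt_fst U).trans (tangentMap_fst_tangentPair X Y)
  have hY : tangentMap _ IP (fun z => z.1.2) W = Y :=
    (tangentMap_comp_fst_tangentPair mdifferentiableAt_snd U).trans (tangentMap_snd_tangentPair X Y)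
  have hU : tangentMap _ IG Prod.snd W = U := tangentMap_snd_tangentPair _ U
  have h_act_fst : MDifferentiableAt ((IP.prod IP).prod IG) IP (fun z => B.act z.1.1 z.2) W.1 :=
    (B.mdifferentiable_act (X.1, U.1)).comp W.1 (h_fst.prodMk mdifferentiableAt_snd)
  have h_act_snd : MDifferentiableAt ((IP.prod IP).prod IG) IP (fun z => B.act z.1.2 z.2) W.1 :=
    (B.mdifferentiable_act (Y.1, U.1)).comp W.1 (h_snd.prodMk mdifferentiableAt_snd)
  nth_rw 2 [← hX]
  nth_rw 2 [← hY]
  rw [← hU, B.tangentAct_tangentMap h_fst mdifferentiableAt_snd,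
    B.tangentAct_tangentMap h_snd mdifferentiableAt_snd, ← tangentMap_prodMk h_act_fst h_act_snd,
    hU]
  rfl

end PairBundle

section TangentToGauge

variable [LieGroup IG ∞ G] (B)

theorem tangentToGauge_zero_zero (p q : P) :
    B.tangentToGauge ⟨p, 0⟩ ⟨q, 0⟩ = ⟨B.toGauge (p, q), 0⟩ :=
  tangentMap_zero B.toGauge (p, q)

variable [IsManifold IM ∞ M]

theorem tangentMap_tgt_tangentToGauge (X Y : TangentBundle IP P) :
    tangentMap ((IM.prod IM).prod IG) IM B.tgt (B.tangentToGauge X Y) =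
      tangentMap IP IM B.proj X :=
  (tangentMap_comp_at _ (B.contMDiff_tgt.mdifferentiable (by simp) _)
    (B.contMDiff_toGauge.mdifferentiable (by simp) _)).symm.trans
  (tangentMap_comp_fst_tangentPair (B.contMDiff_proj.mdifferentiable (by simp) _) Y)

theorem tangentMap_src_tangentToGauge (X Y : TangentBundle IP P) :
    tangentMap ((IM.prod IM).prod IG) IM B.src (B.tangentToGauge X Y) =
      tangentMap IP IM B.proj Y :=
  (tangentMap_comp_at _ (B.contMDiff_src.mdifferentiable (by simp) _)
    (B.contMDiff_toGauge.mdifferentiable (by simp) _)).symm.trans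
  (tangentMap_comp_snd_tangentPair (B.contMDiff_proj.mdifferentiable (by simp) _) X)

theorem tangentToGauge_tangentMap {E : Type*} [NormedAddCommGroup E] [NormedSpace ℝ E]
    {H : Type*} [TopologicalSpace H] {I : ModelWithCorners ℝ E H}
    {N : Type*} [TopologicalSpace N] [ChartedSpace H N] {σ τ : N → P} {Z : TangentBundle I N}
    (hσ : MDifferentiableAt I IP σ Z.1) (hτ : MDifferentiableAt I IP τ Z.1) :
    B.tangentToGauge (tangentMap I IP σ Z) (tangentMap I IP τ Z) =
      tangentMap I ((IM.prod IM).prod IG) (fun x => B.toGauge (σ x, τ x)) Z :=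
  (congrArg (tangentMap _ _ B.toGauge) (tangentMap_prodMk hσ hτ).symm).trans
    (tangentMap_comp_at Z (B.contMDiff_toGauge.mdifferentiable (by simp) _)
      (hσ.prodMk hτ)).symm

theorem exists_tangentToGauge_eq (W : TangentBundle ((IM.prod IM).prod IG) B.GaugeSpace) :
    ∃ X Y, B.tangentToGauge X Y = W := by
  obtain ⟨Z, rfl⟩ := B.pairBundle.tangentMap_proj_surjective W
  obtain ⟨X, Y, rfl⟩ := exists_tangentPair_eq Z
  exact ⟨X, Y, rfl⟩

theorem tangentToGauge_eq_iff {X Y X' Y' : TangentBundle IP P} :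
    B.tangentToGauge X Y = B.tangentToGauge X' Y' ↔
      ∃ U, X' = B.tangentAct X U ∧ Y' = B.tangentAct Y U := by
  refine (B.pairBundle.tangentMap_proj_eq_iff (X := tangentPair X Y)
    (Y := tangentPair X' Y')).trans ?_
  simp only [pairBundle_tangentAct_tangentPair, tangentPair_inj]

theorem tangentToGauge_tangentAct (X Y : TangentBundle IP P) (U : TangentBundle IG G) :
    B.tangentToGauge (B.tangentAct X U) (B.tangentAct Y U) = B.tangentToGauge X Y :=
  (B.tangentToGauge_eq_iff.2 ⟨U, rfl, rfl⟩).symm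

theorem tangentToGauge_left_injective (Y : TangentBundle IP P) :
    Function.Injective fun X => B.tangentToGauge X Y := by
  intro X X' h
  obtain ⟨U, rfl, hY⟩ := B.tangentToGauge_eq_iff.1 h
  obtain rfl : U = ⟨1, 0⟩ :=
    B.tangentAct_left_injective Y (hY.symm.trans (B.tangentAct_one_zero Y).symm)
  exact (B.tangentAct_one_zero X).symm

end TangentToGauge

section TangentGroupoid

section Lift

variable {E : Type*} [NormedAddCommGroup E] [NormedSpace ℝ E]
  {H : Type*} [TopologicalSpace H] {I : ModelWithCorners ℝ E H}
  {N : Type*} [TopologicalSpace N] [ChartedSpace H N] {x : N}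

theorem exists_mdifferentiableAt_proj_eq (B : PrincipalBundle IM IP IG M P G) {γ : N → M}
    (hγ : MDifferentiableAt I IM γ x) :
    ∃ σ : N → P, MDifferentiableAt I IP σ x ∧ ∀ᶠ y in 𝓝 x, B.proj (σ y) = γ y := by
  set e := B.trivAt (γ x)
  have hx : γ x ∈ e.baseSet := mem_baseSet_trivAt _
  refine ⟨fun y => e.sec (γ y) 1, (e.mdifferentiableAt_sec_const hx 1).comp x hγ, ?_⟩
  filter_upwards [hγ.continuousAt.preimage_mem_nhds (e.open_baseSet.mem_nhds hx)] with y hy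
  exact e.proj_sec hy 1

variable [LieGroup IG ∞ G]

theorem exists_mdifferentiableAt_act_eq {σ τ : N → P} (hσ : MDifferentiableAt I IP σ x)
    (hτ : MDifferentiableAt I IP τ x) (h : ∀ᶠ y in 𝓝 x, B.proj (σ y) = B.proj (τ y)) :
    ∃ g : N → G, MDifferentiableAt I IG g x ∧ ∀ᶠ y in 𝓝 x, B.act (σ y) (g y) = τ y := by
  have : LieGroup IG 1 G := .of_le (n := ∞) (by simp)
  set e := B.trivAt (B.proj (σ x))
  have hσx : B.proj (σ x) ∈ e.baseSet := mem_baseSet_trivAt _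
  have hτx : B.proj (τ x) ∈ e.baseSet := h.self_of_nhds ▸ hσx
  have h_fib {ρ : N → P} (hρ : MDifferentiableAt I IP ρ x) (hρx : B.proj (ρ x) ∈ e.baseSet) :
      MDifferentiableAt I IG (fun y => e.fib (ρ y)) x :=
    MDifferentiableAt.comp (g := e.fib) x ((e.contMDiffAt_fib hρx).mdifferentiableAt (by simp)) hρ
  have h_div : MDifferentiable (IG.prod IG) IG (fun z : G × G => z.1⁻¹ * z.2) :=
    (contMDiff_fst.inv.mul contMDiff_snd).mdifferentiable one_ne_zero
  refine ⟨fun y => (e.fib (σ y))⁻¹ * e.fib (τ y),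
    (h_div _).comp x ((h_fib hσ hσx).prodMk (h_fib hτ hτx)), ?_⟩
  filter_upwards [h, hσ.continuousAt.preimage_mem_nhds (e.isOpen_preimage_baseSet.mem_nhds hσx)]
    with y hy hσy
  have hτy : B.proj (τ y) ∈ e.baseSet := hy ▸ hσy
  calc
    _ = B.act (B.act (e.sec (B.proj (σ y)) 1) (e.fib (σ y))) ((e.fib (σ y))⁻¹ * e.fib (τ y)) := by
      rw [e.act_sec_fib hσy]
    _ = τ y := by rw [← B.act_mul, mul_inv_cancel_left, hy, e.act_sec_fib hτy]

variable [IsManifold IM ∞ M]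

theorem exists_mdifferentiableAt_toGauge_eq {γ δ : N → B.GaugeSpace}
    (hγ : MDifferentiableAt I ((IM.prod IM).prod IG) γ x)
    (hδ : MDifferentiableAt I ((IM.prod IM).prod IG) δ x) (h : ∀ y, B.src (γ y) = B.tgt (δ y)) :
    ∃ ρ₁ ρ₂ ρ₃ : N → P, MDifferentiableAt I IP ρ₁ x ∧ MDifferentiableAt I IP ρ₂ x ∧
      MDifferentiableAt I IP ρ₃ x ∧ ∀ᶠ y in 𝓝 x,
        γ y = B.toGauge (ρ₁ y, ρ₂ y) ∧ δ y = B.toGauge (ρ₂ y, ρ₃ y) := by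
  obtain ⟨σ, hσ, h_σ⟩ := B.pairBundle.exists_mdifferentiableAt_proj_eq hγ
  obtain ⟨τ, hτ, h_τ⟩ := B.pairBundle.exists_mdifferentiableAt_proj_eq hδ
  have h_proj : ∀ᶠ y in 𝓝 x, B.proj (τ y).1 = B.proj (σ y).2 := by
    filter_upwards [h_σ, h_τ] with y h_σy h_τy
    have h_y := h y
    rw [← h_σy, ← h_τy] at h_y
    exact h_y.symm
  have hτ₁ : MDifferentiableAt I IP (fun y => (τ y).1) x := mdifferentiableAt_fst.comp x hτ
  have hτ₂ : MDifferentiableAt I IP (fun y => (τ y).2) x := mdifferentiableAt_snd.comp x hτ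
  have hσ₂ : MDifferentiableAt I IP (fun y => (σ y).2) x := mdifferentiableAt_snd.comp x hσ
  obtain ⟨g, hg, h_g⟩ := exists_mdifferentiableAt_act_eq hτ₁ hσ₂ h_proj
  refine ⟨fun y => (σ y).1, fun y => (σ y).2, fun y => B.act (τ y).2 (g y),
    mdifferentiableAt_fst.comp x hσ, hσ₂, (B.mdifferentiable_act _).comp x (hτ₂.prodMk hg), ?_⟩
  filter_upwards [h_σ, h_τ, h_g] with y h_σy h_τy h_gy
  refine ⟨h_σy.symm, ?_⟩
  rw [← h_gy, toGauge_act]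
  exact h_τy.symm

end Lift

variable [LieGroup IG ∞ G] [IsManifold IM ∞ M]

theorem velocity_eq_tangentToGauge {γ : ℝ → B.GaugeSpace} {σ τ : ℝ → P}
    (hσ : MDifferentiableAt 𝓘(ℝ, ℝ) IP σ 0) (hτ : MDifferentiableAt 𝓘(ℝ, ℝ) IP τ 0)
    (h : ∀ᶠ t in 𝓝 0, γ t = B.toGauge (σ t, τ t)) :
    velocity ((IM.prod IM).prod IG) γ = B.tangentToGauge (velocity IP σ) (velocity IP τ) := by
  rw [velocity, velocity, velocity, B.tangentToGauge_tangentMap hσ hτ]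
  exact tangentMap_congr h

theorem exists_tangentToGauge_eq_of_isTangentMul
    {W₁ W₂ W₃ : TangentBundle ((IM.prod IM).prod IG) B.GaugeSpace}
    (h : B.gaugeGroupoid.IsTangentMul ((IM.prod IM).prod IG) W₁ W₂ W₃) :
    ∃ X Y Z, B.tangentToGauge X Y = W₁ ∧ B.tangentToGauge Y Z = W₂ ∧
      B.tangentToGauge X Z = W₃ := by
  obtain ⟨γ, δ, h_comp, hγ, hδ, rfl, rfl, rfl⟩ := h
  obtain ⟨ρ₁, ρ₂, ρ₃, h₁, h₂, h₃, h_eq⟩ := exists_mdifferentiableAt_toGauge_eq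
    (hγ.mdifferentiable (by simp) 0) (hδ.mdifferentiable (by simp) 0) h_comp
  refine ⟨_, _, _, (velocity_eq_tangentToGauge h₁ h₂ (h_eq.mono fun _ ht => ht.1)).symm,
    (velocity_eq_tangentToGauge h₂ h₃ (h_eq.mono fun _ ht => ht.2)).symm,
    (velocity_eq_tangentToGauge h₁ h₃ ?_).symm⟩
  filter_upwards [h_eq] with t ⟨hγt, hδt⟩
  simp only [hγt, hδt]
  exact B.gaugeMul_toGauge _ _ _ rfl

theorem eq_tangentToGauge_of_isTangentMul {X Y Z : TangentBundle IP P}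
    {W : TangentBundle ((IM.prod IM).prod IG) B.GaugeSpace}
    (h : B.gaugeGroupoid.IsTangentMul ((IM.prod IM).prod IG) (B.tangentToGauge X Y)
      (B.tangentToGauge Y Z) W) : W = B.tangentToGauge X Z := by
  obtain ⟨X', Y', Z', hXY, hYZ, rfl⟩ := exists_tangentToGauge_eq_of_isTangentMul h
  obtain ⟨U, rfl, rfl⟩ := B.tangentToGauge_eq_iff.1 hXY.symm
  obtain ⟨V, hY, rfl⟩ := B.tangentToGauge_eq_iff.1 hYZ.symm
  rw [B.tangentAct_left_injective Y hY, tangentToGauge_tangentAct]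

theorem eq_tangentToGauge_of_isTangentMul_right {X Y Z : TangentBundle IP P}
    {W : TangentBundle ((IM.prod IM).prod IG) B.GaugeSpace}
    (h : B.gaugeGroupoid.IsTangentMul ((IM.prod IM).prod IG) W (B.tangentToGauge Y Z)
      (B.tangentToGauge X Z)) : W = B.tangentToGauge X Y := by
  obtain ⟨X', Y', Z', rfl, hYZ, hXZ⟩ := exists_tangentToGauge_eq_of_isTangentMul h
  obtain ⟨U, rfl, rfl⟩ := B.tangentToGauge_eq_iff.1 hYZ.symm
  obtain ⟨V, rfl, hZ⟩ := B.tangentToGauge_eq_iff.1 hXZ.symm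
  rw [B.tangentAct_left_injective Z hZ, tangentToGauge_tangentAct]

variable [IsManifold IP ∞ P] [BoundarylessManifold IP P]

theorem isTangentMul_tangentToGauge (X Y Z : TangentBundle IP P) :
    B.gaugeGroupoid.IsTangentMul ((IM.prod IM).prod IG) (B.tangentToGauge X Y)
      (B.tangentToGauge Y Z) (B.tangentToGauge X Z) := by
  obtain ⟨α, hα, rfl⟩ := exists_contMDiff_velocity_eq X BoundarylessManifold.isInteriorPoint
  obtain ⟨β, hβ, rfl⟩ := exists_contMDiff_velocity_eq Y BoundarylessManifold.isInteriorPoint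
  obtain ⟨ζ, hζ, rfl⟩ := exists_contMDiff_velocity_eq Z BoundarylessManifold.isInteriorPoint
  have h_vel {σ τ : ℝ → P} {γ : ℝ → B.GaugeSpace} (hσ : ContMDiff 𝓘(ℝ, ℝ) IP ∞ σ)
      (hτ : ContMDiff 𝓘(ℝ, ℝ) IP ∞ τ) (h : ∀ t, γ t = B.toGauge (σ t, τ t)) :=
    velocity_eq_tangentToGauge (hσ.mdifferentiable (by simp) 0) (hτ.mdifferentiable (by simp) 0)
      (.of_forall h)
  exact ⟨fun t => B.toGauge (α t, β t), fun t => B.toGauge (β t, ζ t), fun _ => rfl,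
    B.contMDiff_toGauge.comp (hα.prodMk hβ), B.contMDiff_toGauge.comp (hβ.prodMk hζ),
    h_vel hα hβ fun _ => rfl, h_vel hβ hζ fun _ => rfl,
    h_vel hα hζ fun t => B.gaugeMul_toGauge (α t) (β t) (ζ t) rfl⟩

theorem isTangentMul_iff {W₁ W₂ W₃ : TangentBundle ((IM.prod IM).prod IG) B.GaugeSpace} :
    B.gaugeGroupoid.IsTangentMul ((IM.prod IM).prod IG) W₁ W₂ W₃ ↔
      ∃ X Y Z, B.tangentToGauge X Y = W₁ ∧ B.tangentToGauge Y Z = W₂ ∧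
        B.tangentToGauge X Z = W₃ := by
  refine ⟨exists_tangentToGauge_eq_of_isTangentMul, ?_⟩
  rintro ⟨X, Y, Z, rfl, rfl, rfl⟩
  exact isTangentMul_tangentToGauge X Y Z

end TangentGroupoid

section TangentGroup

variable [LieGroup IG ∞ G]

theorem tangentMul_zero_adjointAction (g : G) (u : GroupLieAlgebra IG G) :
    tangentMul (⟨g, 0⟩ : TangentBundle IG G) ⟨1, adjointAction IG g⁻¹ u⟩ =
      tangentMul ⟨1, u⟩ ⟨g, 0⟩ := by
  have : LieGroup IG 1 G := .of_le (n := ∞) (by simp)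
  set U : TangentBundle IG G := ⟨1, u⟩
  have h_conj : MDifferentiable IG IG (fun h : G => g⁻¹ * h * g⁻¹⁻¹) :=
    ((contMDiff_const.mul contMDiff_id).mul contMDiff_const).mdifferentiable one_ne_zero
  have h_adjoint : tangentMap IG IG (fun h : G => g⁻¹ * h * g⁻¹⁻¹) U =
      ⟨1, adjointAction IG g⁻¹ u⟩ := tangentBundle_ext (by simp [U]) rfl
  calc
    _ = tangentMap IG IG (fun h => g * (g⁻¹ * h * g⁻¹⁻¹)) U := by
      rw [← h_adjoint, ← tangentMap_const (I := IG) g U]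
      exact tangentMul_tangentMap mdifferentiableAt_const (h_conj _)
    _ = tangentMap IG IG (fun h => id h * g) U := by
      simp only [← mul_assoc, mul_inv_cancel, one_mul, inv_inv, id]
    _ = tangentMul U ⟨g, 0⟩ := by
      rw [← tangentMul_tangentMap mdifferentiableAt_id mdifferentiableAt_const,
        tangentMap_id, tangentMap_const, id]

theorem exists_tangentMul_zero_one_eq (U : TangentBundle IG G) :
    ∃ v : GroupLieAlgebra IG G, tangentMul ⟨U.1, 0⟩ ⟨1, v⟩ = U := by
  have : LieGroup IG 1 G := .of_le (n := ∞) (by simp)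
  obtain ⟨⟨g, v⟩, hV⟩ := (tangentMul_bijective (⟨U.1, 0⟩ : TangentBundle IG G)).2 U
  obtain rfl : g = 1 := mul_eq_left.1 (congrArg TotalSpace.proj hV)
  exact ⟨v, hV⟩

variable (B)

theorem tangentAct_generator_zero (p : P) (u : GroupLieAlgebra IG G) (g : G) :
    B.tangentAct ⟨p, B.generator u p⟩ ⟨g, 0⟩ =
      ⟨B.act p g, B.generator (adjointAction IG g⁻¹ u) (B.act p g)⟩ := by
  rw [← tangentAct_zero_one, tangentAct_tangentAct, ← tangentMul_zero_adjointAction,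
    ← tangentAct_tangentAct, tangentAct_zero_zero, tangentAct_zero_one]

end TangentGroup

namespace PrincipalConnection

variable [IsManifold IP ∞ P] (θ : B.PrincipalConnection)

theorem verticalProjection_mem (X : TangentBundle IP P) :
    θ.verticalProjection X ∈ B.verticalBundle :=
  ⟨θ.toFun X.1 X.2, rfl⟩

theorem verticalProjection_eq_self {X : TangentBundle IP P} (hX : X ∈ B.verticalBundle) :
    θ.verticalProjection X = X := by
  obtain ⟨u, hu⟩ := hX
  refine tangentBundle_ext rfl ?_
  change B.generator (θ.toFun X.1 X.2) X.1 = X.2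
  rw [hu, θ.map_generator]

theorem verticalProjection_zero (p : P) : θ.verticalProjection ⟨p, 0⟩ = ⟨p, 0⟩ :=
  θ.verticalProjection_eq_self ⟨0, (map_zero (mfderiv IG IP (B.act p) 1 : EG →L[ℝ] EP)).symm⟩

theorem verticalProjection_injective :
    Function.Injective fun θ : B.PrincipalConnection => θ.verticalProjection := by
  intro θ θ' h
  refine PrincipalConnection.ext (funext fun p => ContinuousLinearMap.ext fun v => ?_)
  have h_gen : (⟨p, B.generator (θ.toFun p v) p⟩ : TangentBundle IP P) =
    ⟨p, B.generator (θ'.toFun p v) p⟩ := congrFun h ⟨p, v⟩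
  have h_gen' := TotalSpace.mk_injective p h_gen
  rw [← θ.map_generator p (θ.toFun p v), h_gen', θ.map_generator]

variable [LieGroup IG ∞ G]

theorem verticalProjection_tangentAct (X : TangentBundle IP P) (U : TangentBundle IG G) :
    θ.verticalProjection (B.tangentAct X U) = B.tangentAct (θ.verticalProjection X) U := by
  have h_zero (Y : TangentBundle IP P) (g : G) : θ.verticalProjection (B.tangentAct Y ⟨g, 0⟩) =
      B.tangentAct (θ.verticalProjection Y) ⟨g, 0⟩ := by
    rw [tangentAct_zero_right, verticalProjection, verticalProjection, tangentAct_generator_zero]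
    exact tangentBundle_ext rfl (congrArg (B.generator · _) (θ.map_act Y.1 g Y.2))
  have h_one (Y : TangentBundle IP P) (v : GroupLieAlgebra IG G) :
      θ.verticalProjection (B.tangentAct Y ⟨1, v⟩) =
        B.tangentAct (θ.verticalProjection Y) ⟨1, v⟩ := by
    rw [tangentAct_one, tangentAct_one]
    refine tangentBundle_ext rfl ?_
    change B.generator (θ.toFun Y.1 (Y.2 + B.generator v Y.1)) Y.1 = _
    rw [map_add, θ.map_generator]
    exact map_add (mfderiv IG IP (B.act Y.1) 1 : EG →L[ℝ] EP) _ _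
  obtain ⟨v, hv⟩ := exists_tangentMul_zero_one_eq U
  rw [← hv, ← tangentAct_tangentAct, h_one, h_zero, tangentAct_tangentAct]

/-- The endomorphism `Θ` of `TP` as a vector-valued one-form. -/
def verticalForm : VectorValuedOneForm IP P where
  toFun p := (mfderiv IG IP (B.act p) 1 : EG →L[ℝ] EP) ∘L (θ.toFun p : EP →L[ℝ] EG)
  contMDiff_toFun := by
    have : IsManifold IG ∞ G := ContMDiffMul.toIsManifold
    have h_unit : ContMDiff IP.tangent IG.tangent ∞
        (fun X : TangentBundle IP P => (⟨1, θ.toFun X.1 X.2⟩ : TangentBundle IG G)) :=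
      fun X => contMDiffAt_mk_const_iff.2 (θ.contMDiff_toFun X)
    have h_base : ContMDiff IP.tangent IP.tangent ∞
        (fun X : TangentBundle IP P => (⟨X.1, 0⟩ : TangentBundle IP P)) :=
      contMDiff_zeroVector.comp (Bundle.contMDiff_proj (TangentSpace IP))
    refine ((contMDiff_tangentMap B.contMDiff_act).comp
      (contMDiff_tangentPair.comp (h_base.prodMk h_unit))).congr fun X => ?_
    exact (B.tangentAct_zero_one X.1 (θ.toFun X.1 X.2)).symm

theorem verticalForm_map (X : TangentBundle IP P) :
    θ.verticalForm.map X = θ.verticalProjection X := rfl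

variable [IsManifold IM ∞ M]

theorem exists_map_tangentToGauge_eq :
    ∃ K : VectorValuedOneForm ((IM.prod IM).prod IG) B.GaugeSpace, ∀ X Y,
      K.map (B.tangentToGauge X Y) =
        B.tangentToGauge (θ.verticalProjection X) (θ.verticalProjection Y) := by
  obtain ⟨K, hK⟩ := B.pairBundle.exists_map_tangentMap_proj_eq
    (θ.verticalForm.prod θ.verticalForm) fun W U => by
      obtain ⟨X, Y, rfl⟩ := exists_tangentPair_eq W
      simp only [pairBundle_tangentAct_tangentPair, VectorValuedOneForm.prod_map_tangentPair,
        verticalForm_map, verticalProjection_tangentAct]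
      exact B.tangentToGauge_tangentAct _ _ U
  exact ⟨K, fun X Y => hK (tangentPair X Y)⟩

/-- The vector-valued one-form on the gauge groupoid associated with `θ`, obtained by descent of
`Θ × Θ` along `P × P → 𝒢(P)`. -/
def gaugeForm : VectorValuedOneForm ((IM.prod IM).prod IG) B.GaugeSpace :=
  θ.exists_map_tangentToGauge_eq.choose

theorem gaugeForm_map_tangentToGauge (X Y : TangentBundle IP P) :
    θ.gaugeForm.map (B.tangentToGauge X Y) =
      B.tangentToGauge (θ.verticalProjection X) (θ.verticalProjection Y) :=
  θ.exists_map_tangentToGauge_eq.choose_spec X Y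

theorem gaugeForm_injective : Function.Injective fun θ : B.PrincipalConnection => θ.gaugeForm := by
  intro θ θ' (h : θ.gaugeForm = θ'.gaugeForm)
  refine verticalProjection_injective (funext fun X => ?_)
  refine B.tangentToGauge_left_injective ⟨X.1, 0⟩ ?_
  have h_map := θ.gaugeForm_map_tangentToGauge X ⟨X.1, 0⟩
  rwa [h, gaugeForm_map_tangentToGauge, verticalProjection_zero, verticalProjection_zero,
    eq_comm] at h_map

theorem gaugeForm_map_gaugeForm_map (W : TangentBundle ((IM.prod IM).prod IG) B.GaugeSpace) :
    θ.gaugeForm.map (θ.gaugeForm.map W) = θ.gaugeForm.map W := by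
  obtain ⟨X, Y, rfl⟩ := B.exists_tangentToGauge_eq W
  simp only [gaugeForm_map_tangentToGauge,
    θ.verticalProjection_eq_self (θ.verticalProjection_mem _)]

theorem range_gaugeForm_map : Set.range θ.gaugeForm.map = B.gaugeVertical := by
  ext W
  constructor
  · rintro ⟨W, rfl⟩
    obtain ⟨X, Y, rfl⟩ := B.exists_tangentToGauge_eq W
    exact ⟨_, θ.verticalProjection_mem X, _, θ.verticalProjection_mem Y,
      (θ.gaugeForm_map_tangentToGauge X Y).symm⟩
  · rintro ⟨X, hX, Y, hY, rfl⟩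
    refine ⟨B.tangentToGauge X Y, ?_⟩
    rw [gaugeForm_map_tangentToGauge, θ.verticalProjection_eq_self hX,
      θ.verticalProjection_eq_self hY]

theorem isMultiplicative_gaugeForm [BoundarylessManifold IP P] :
    B.gaugeGroupoid.IsMultiplicative IM θ.gaugeForm := by
  have h_proj (X : TangentBundle IP P) : tangentMap IP IM B.proj (θ.verticalProjection X) =
      (0 : VectorValuedOneForm IM M).map (tangentMap IP IM B.proj X) :=
    B.mem_verticalBundle_iff.1 (θ.verticalProjection_mem X)
  refine ⟨0, fun W => ?_, fun W => ?_, fun W₁ W₂ W₃ h => ?_⟩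
  · obtain ⟨X, Y, rfl⟩ := B.exists_tangentToGauge_eq W
    rw [gaugeForm_map_tangentToGauge]
    exact (B.tangentMap_src_tangentToGauge _ _).trans <| (h_proj Y).trans <|
      congrArg _ (B.tangentMap_src_tangentToGauge X Y).symm
  · obtain ⟨X, Y, rfl⟩ := B.exists_tangentToGauge_eq W
    rw [gaugeForm_map_tangentToGauge]
    exact (B.tangentMap_tgt_tangentToGauge _ _).trans <| (h_proj X).trans <|
      congrArg _ (B.tangentMap_tgt_tangentToGauge X Y).symm
  · obtain ⟨X, Y, Z, rfl, rfl, rfl⟩ := isTangentMul_iff.1 h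
    simp only [gaugeForm_map_tangentToGauge]
    exact isTangentMul_tangentToGauge _ _ _

end PrincipalConnection

section IsotropyCoord

variable [LieGroup IG ∞ G]

/-- The map `(p, \overline{(p · g, p)}) ↦ g`, extended to a neighbourhood through the local
trivialization `e`. It reads off the element of `G` by which an arrow of the isotropy group of
`π p` translates `p`. -/
def LocalTriv.isotropyCoord (e : B.LocalTriv) (w : P × B.GaugeSpace) : G :=
  (e.fib w.1)⁻¹ * (gaugeTriv e e w.2).2 * e.fib w.1

theorem LocalTriv.isotropyCoord_toGauge_act (e : B.LocalTriv) {p : P} (hp : B.proj p ∈ e.baseSet)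
    (g : G) : e.isotropyCoord (p, B.toGauge (B.act p g, p)) = g := by
  have h_act : B.proj (B.act p g) ∈ e.baseSet := (B.proj_act p g).symm ▸ hp
  simp only [isotropyCoord, gaugeTriv_toGauge e e h_act hp, e.fib_act hp]
  group

variable [IsManifold IM ∞ M]

theorem LocalTriv.contMDiffOn_isotropyCoord (e : B.LocalTriv) :
    ContMDiffOn (IP.prod ((IM.prod IM).prod IG)) IG ∞ e.isotropyCoord
      ((B.proj ⁻¹' e.baseSet) ×ˢ (gaugeTriv e e).source) := by
  have h_coord : ContMDiffOn ((IM.prod IM).prod IG) IG ∞ (fun z => (gaugeTriv e e z).2)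
      (gaugeTriv e e).source := contMDiff_snd.comp_contMDiffOn (contMDiffOn_gaugeTriv e e)
  have h_fib := e.contMDiffOn_fib.comp (contMDiff_fst (I := IP) (J := (IM.prod IM).prod IG)
    (M := P) (N := B.GaugeSpace)).contMDiffOn
    (s := (B.proj ⁻¹' e.baseSet) ×ˢ (gaugeTriv e e).source) fun _ hw => hw.1
  exact (h_fib.inv.mul (h_coord.comp contMDiff_snd.contMDiffOn fun _ hw => hw.2)).mul h_fib

theorem LocalTriv.mdifferentiableAt_isotropyCoord (e : B.LocalTriv) {p q r : P}
    (hp : B.proj p ∈ e.baseSet) (hq : B.proj q ∈ e.baseSet) (hr : B.proj r ∈ e.baseSet) :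
    MDifferentiableAt (IP.prod ((IM.prod IM).prod IG)) IG e.isotropyCoord
      (p, B.toGauge (q, r)) :=
  (e.contMDiffOn_isotropyCoord.contMDiffAt <|
    (e.isOpen_preimage_baseSet.prod (gaugeTriv e e).open_source).mem_nhds
      (x := (p, B.toGauge (q, r))) ⟨hp, hq, hr⟩).mdifferentiableAt (by simp)

theorem LocalTriv.tangentMap_isotropyCoord_tangentAct (e : B.LocalTriv) {p : P}
    (hp : B.proj p ∈ e.baseSet) (U : TangentBundle IG G) :
    tangentMap (IP.prod ((IM.prod IM).prod IG)) IG e.isotropyCoord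
      (tangentPair ⟨p, 0⟩ (B.tangentToGauge (B.tangentAct ⟨p, 0⟩ U) ⟨p, 0⟩)) = U := by
  have h_coord := e.mdifferentiableAt_isotropyCoord hp ((B.proj_act p U.1).symm ▸ hp) hp
  have h_act : MDifferentiableAt IG IP (B.act p) U.1 :=
    (B.mdifferentiable_act (p, U.1)).comp U.1 (mdifferentiableAt_const.prodMk mdifferentiableAt_id)
  have h_arrow : MDifferentiableAt IG ((IM.prod IM).prod IG)
      (fun g : G => B.toGauge (B.act p g, p)) U.1 :=
    (B.contMDiff_toGauge.mdifferentiable (by simp) (B.act p U.1, p)).comp U.1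
      (h_act.prodMk mdifferentiableAt_const)
  rw [tangentAct_zero_left, ← tangentMap_const (I := IG) p U,
    B.tangentToGauge_tangentMap h_act mdifferentiableAt_const,
    ← tangentMap_prodMk mdifferentiableAt_const h_arrow,
    ← tangentMap_comp_at U h_coord (mdifferentiableAt_const.prodMk h_arrow)]
  exact (tangentMap_congr (.of_forall (e.isotropyCoord_toGauge_act hp))).trans
    (congrFun tangentMap_id U)

theorem LocalTriv.tangentMap_isotropyCoord_generator (e : B.LocalTriv) {p : P}
    (hp : B.proj p ∈ e.baseSet) (u : GroupLieAlgebra IG G) :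
    tangentMap (IP.prod ((IM.prod IM).prod IG)) IG e.isotropyCoord
      (tangentPair ⟨p, 0⟩ (B.tangentToGauge ⟨p, B.generator u p⟩ ⟨p, 0⟩)) = ⟨1, u⟩ := by
  rw [← tangentAct_zero_one, e.tangentMap_isotropyCoord_tangentAct hp]

end IsotropyCoord

section GaugeVertical

variable [LieGroup IG ∞ G]

theorem tangentToGauge_generator_mem_gaugeVertical (p : P) (u : GroupLieAlgebra IG G) (q : P) :
    B.tangentToGauge ⟨p, B.generator u p⟩ ⟨q, 0⟩ ∈ B.gaugeVertical :=
  ⟨_, ⟨u, rfl⟩, _, ⟨0, (map_zero (mfderiv IG IP (B.act q) 1 : EG →L[ℝ] EP)).symm⟩, rfl⟩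

variable [IsManifold IM ∞ M]

theorem exists_tangentToGauge_generator_eq
    {W : TangentBundle ((IM.prod IM).prod IG) B.GaugeSpace} (hW : W ∈ B.gaugeVertical) {p q : P}
    (h : W.1 = B.toGauge (p, q)) :
    ∃ u, W = B.tangentToGauge ⟨p, B.generator u p⟩ ⟨q, 0⟩ := by
  obtain ⟨X, hX, Y, hY, rfl⟩ := hW
  have hq : B.proj Y.1 = B.proj q := congrArg B.src h
  obtain ⟨U, hU⟩ := (B.tangentMap_proj_eq_iff (X := Y) (Y := ⟨q, 0⟩)).1 <| by
    rw [B.mem_verticalBundle_iff.1 hY, tangentMap_zero, hq]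
  obtain ⟨g, hg⟩ := B.toGauge_eq_iff.1 (h.symm.trans (B.toGauge_act X.1 Y.1 U.1).symm)
  have h_point : B.act Y.1 U.1 = q := (congrArg TotalSpace.proj hU).symm
  obtain rfl : g = 1 := B.act_eq_self ((congrArg Prod.snd hg).symm.trans h_point)
  have h_base : (B.tangentAct X U).1 = p := (congrArg Prod.fst hg).trans (B.act_one p)
  have h_vertical : B.tangentAct X U ∈ B.verticalBundle := by
    rw [B.mem_verticalBundle_iff, tangentMap_proj_tangentAct, B.mem_verticalBundle_iff.1 hX]
    exact tangentBundle_ext (B.proj_act X.1 U.1).symm rfl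
  obtain ⟨u, hu⟩ := h_vertical
  refine ⟨u, ?_⟩
  rw [← B.tangentToGauge_tangentAct X Y U, ← hU]
  subst h_base
  exact congrArg (B.tangentToGauge · _) (tangentBundle_ext rfl hu)

end GaugeVertical

section ConnectionForm

variable [LieGroup IG ∞ G] [IsManifold IM ∞ M]
  {K : VectorValuedOneForm ((IM.prod IM).prod IG) B.GaugeSpace}

theorem map_eq_self_of_mem_gaugeVertical (h_idem : ∀ W, K.map (K.map W) = K.map W)
    (h_range : Set.range K.map = B.gaugeVertical)
    {W : TangentBundle ((IM.prod IM).prod IG) B.GaugeSpace} (hW : W ∈ B.gaugeVertical) :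
    K.map W = W := by
  obtain ⟨W, rfl⟩ := h_range.symm.subset hW
  exact h_idem W

theorem exists_map_tangentToGauge_zero_eq (h_range : Set.range K.map ⊆ B.gaugeVertical)
    (X : TangentBundle IP P) (q : P) : ∃ u, K.map (B.tangentToGauge X ⟨q, 0⟩) =
      B.tangentToGauge ⟨X.1, B.generator u X.1⟩ ⟨q, 0⟩ :=
  exists_tangentToGauge_generator_eq (h_range ⟨_, rfl⟩) rfl

variable (K) in
/-- The value at `p` of the `𝔤`-valued one-form `θ` on `P` given by
`K\overline{(X, 0_p)} = \overline{((θ X)_P, 0_p)}`. -/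
def isotropyForm (p : P) : TangentSpace IP p →L[ℝ] GroupLieAlgebra IG G :=
  (mfderiv ((IM.prod IM).prod IG) IG
      (fun z => (B.trivAt (B.proj p)).isotropyCoord (p, z)) (B.toGauge (p, p)) :
        (EM × EM) × EG →L[ℝ] EG) ∘L
    (K.toFun (B.toGauge (p, p)) : (EM × EM) × EG →L[ℝ] (EM × EM) × EG) ∘L
    (mfderiv IP ((IM.prod IM).prod IG) (fun q => B.toGauge (q, p)) p : EP →L[ℝ] (EM × EM) × EG)

theorem mk_isotropyForm (X : TangentBundle IP P) :
    (⟨1, B.isotropyForm K X.1 X.2⟩ : TangentBundle IG G) =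
      tangentMap (IP.prod ((IM.prod IM).prod IG)) IG (B.trivAt (B.proj X.1)).isotropyCoord
        (tangentPair ⟨X.1, 0⟩ (K.map (B.tangentToGauge X ⟨X.1, 0⟩))) := by
  set e := B.trivAt (B.proj X.1)
  have hX : B.proj X.1 ∈ e.baseSet := mem_baseSet_trivAt _
  have h_unit : e.isotropyCoord (X.1, B.toGauge (X.1, X.1)) = 1 := by
    simpa only [B.act_one] using e.isotropyCoord_toGauge_act hX 1
  have h_arrow : B.tangentToGauge X ⟨X.1, 0⟩ =
      tangentMap IP ((IM.prod IM).prod IG) (fun q => B.toGauge (q, X.1)) X :=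
    tangentMap_tangentPair_zero_right (B.contMDiff_toGauge.mdifferentiable (by simp) _)
  rw [h_arrow, tangentMap_tangentPair_zero_left (e.mdifferentiableAt_isotropyCoord hX hX hX)]
  exact tangentBundle_ext h_unit.symm rfl

theorem isotropyForm_eq_of_map_tangentToGauge_eq {X : TangentBundle IP P} {u : GroupLieAlgebra IG G}
    (h : K.map (B.tangentToGauge X ⟨X.1, 0⟩) =
      B.tangentToGauge ⟨X.1, B.generator u X.1⟩ ⟨X.1, 0⟩) : B.isotropyForm K X.1 X.2 = u := by
  refine TotalSpace.mk_injective (F := EG) (E := TangentSpace IG) 1 ?_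
  rw [mk_isotropyForm, h, LocalTriv.tangentMap_isotropyCoord_generator _ (mem_baseSet_trivAt _)]

theorem map_tangentToGauge_zero_self (h_range : Set.range K.map ⊆ B.gaugeVertical)
    (X : TangentBundle IP P) : K.map (B.tangentToGauge X ⟨X.1, 0⟩) =
      B.tangentToGauge ⟨X.1, B.generator (B.isotropyForm K X.1 X.2) X.1⟩ ⟨X.1, 0⟩ := by
  obtain ⟨u, hu⟩ := exists_map_tangentToGauge_zero_eq h_range X X.1
  rwa [isotropyForm_eq_of_map_tangentToGauge_eq hu]

theorem isotropyForm_generator (h : ∀ W ∈ B.gaugeVertical, K.map W = W) (p : P)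
    (u : GroupLieAlgebra IG G) : B.isotropyForm K p (B.generator u p) = u :=
  isotropyForm_eq_of_map_tangentToGauge_eq (X := ⟨p, B.generator u p⟩)
    (h _ (tangentToGauge_generator_mem_gaugeVertical p u p))

theorem isotropyForm_tangentMap_act (h_range : Set.range K.map ⊆ B.gaugeVertical) (g : G)
    (X : TangentBundle IP P) :
    B.isotropyForm K (B.act X.1 g) (tangentMap IP IP (fun p => B.act p g) X).2 =
      adjointAction IG g⁻¹ (B.isotropyForm K X.1 X.2) := by
  have h_translate (Y : TangentBundle IP P) :
      B.tangentToGauge (B.tangentAct Y ⟨g, 0⟩) ⟨B.act X.1 g, 0⟩ = B.tangentToGauge Y ⟨X.1, 0⟩ := by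
    rw [← tangentAct_zero_zero, tangentToGauge_tangentAct]
  refine isotropyForm_eq_of_map_tangentToGauge_eq (X := tangentMap IP IP (fun p => B.act p g) X) ?_
  change K.map (B.tangentToGauge (tangentMap IP IP (fun p => B.act p g) X) ⟨B.act X.1 g, 0⟩) =
    B.tangentToGauge ⟨B.act X.1 g, B.generator _ (B.act X.1 g)⟩ ⟨B.act X.1 g, 0⟩
  rw [← tangentAct_zero_right, h_translate, map_tangentToGauge_zero_self h_range,
    ← tangentAct_generator_zero, h_translate]

variable [IsManifold IP ∞ P]

theorem contMDiff_isotropyForm (h_range : Set.range K.map ⊆ B.gaugeVertical) :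
    ContMDiff (M' := EG) IP.tangent 𝓘(ℝ, EG) ∞
      (fun X : TangentBundle IP P => B.isotropyForm K X.1 X.2) := by
  have : IsManifold IG ∞ G := ContMDiffMul.toIsManifold
  intro X
  set e := B.trivAt (B.proj X.1)
  have hX : B.proj X.1 ∈ e.baseSet := mem_baseSet_trivAt _
  have h_zero : ContMDiff IP.tangent IP.tangent ∞
      (fun Y : TangentBundle IP P => (⟨Y.1, 0⟩ : TangentBundle IP P)) :=
    contMDiff_zeroVector.comp (Bundle.contMDiff_proj (TangentSpace IP))
  have h_form : ContMDiff IP.tangent ((IM.prod IM).prod IG).tangent ∞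
      (fun Y : TangentBundle IP P => K.map (B.tangentToGauge Y ⟨Y.1, 0⟩)) :=
    K.contMDiff_toFun.comp <| (contMDiff_tangentMap B.contMDiff_toGauge).comp <|
      contMDiff_tangentPair.comp (contMDiff_id.prodMk h_zero)
  have h_coord := contMDiffAt_tangentMap e.contMDiffOn_isotropyCoord
    (e.isOpen_preimage_baseSet.prod (gaugeTriv e e).open_source)
    (X := tangentPair ⟨X.1, 0⟩ (K.map (B.tangentToGauge X ⟨X.1, 0⟩))) ⟨hX, hX, hX⟩
  refine (contMDiffAt_mk_const_iff (I := IG) (x := (1 : G))).1 <|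
    (h_coord.comp X (contMDiff_tangentPair.comp
      (h_zero.prodMk h_form)).contMDiffAt).congr_of_eventuallyEq ?_
  filter_upwards [(e.isOpen_preimage_baseSet.preimage
    (FiberBundle.continuous_proj EP (TangentSpace IP))).mem_nhds hX] with Y hY
  exact (congrArg _ (congrArg _ (map_tangentToGauge_zero_self h_range Y))).trans
    (e.tangentMap_isotropyCoord_generator hY _) |>.symm

theorem map_tangentToGauge_of_isMultiplicative [BoundarylessManifold IP P]
    (h_mul : B.gaugeGroupoid.IsMultiplicative IM K) {Θ : TangentBundle IP P → TangentBundle IP P}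
    (h_zero : ∀ X, K.map (B.tangentToGauge X ⟨X.1, 0⟩) = B.tangentToGauge (Θ X) ⟨X.1, 0⟩)
    (X Y : TangentBundle IP P) :
    K.map (B.tangentToGauge X Y) = B.tangentToGauge (Θ X) (Θ Y) := by
  obtain ⟨-, -, -, h_mul⟩ := h_mul
  have h_zero_zero (p q : P) : K.map (B.tangentToGauge ⟨p, 0⟩ ⟨q, 0⟩) =
      B.tangentToGauge ⟨p, 0⟩ ⟨q, 0⟩ := by
    simp only [tangentToGauge_zero_zero, K.map_mk_zero]
  have h_zero_right (X : TangentBundle IP P) (q : P) : K.map (B.tangentToGauge X ⟨q, 0⟩) =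
      B.tangentToGauge (Θ X) ⟨q, 0⟩ := by
    have h := h_mul _ _ _ (isTangentMul_tangentToGauge X ⟨X.1, 0⟩ ⟨q, 0⟩)
    rw [h_zero, h_zero_zero] at h
    exact eq_tangentToGauge_of_isTangentMul h
  have h := h_mul _ _ _ (isTangentMul_tangentToGauge X Y ⟨Y.1, 0⟩)
  rw [h_zero_right, h_zero_right] at h
  exact eq_tangentToGauge_of_isTangentMul_right h

variable (h_idem : ∀ W, K.map (K.map W) = K.map W) (h_range : Set.range K.map = B.gaugeVertical)

/-- The principal connection `θ` on `P` determined by a projection `K` of `T𝒢(P)` onto `Δ_V`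
through `K\overline{(X, 0_p)} = \overline{((θ X)_P, 0_p)}`. -/
def connectionOfForm : B.PrincipalConnection where
  toFun := B.isotropyForm K
  contMDiff_toFun := contMDiff_isotropyForm h_range.subset
  map_generator := isotropyForm_generator fun _ => map_eq_self_of_mem_gaugeVertical h_idem h_range
  map_act p g v := isotropyForm_tangentMap_act h_range.subset g ⟨p, v⟩

theorem gaugeForm_connectionOfForm [BoundarylessManifold IP P]
    (h_mul : B.gaugeGroupoid.IsMultiplicative IM K) :
    (connectionOfForm h_idem h_range).gaugeForm = K := by
  refine VectorValuedOneForm.map_injective (funext fun W => ?_)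
  obtain ⟨X, Y, rfl⟩ := B.exists_tangentToGauge_eq W
  rw [PrincipalConnection.gaugeForm_map_tangentToGauge]
  exact (map_tangentToGauge_of_isMultiplicative h_mul
    (map_tangentToGauge_zero_self h_range.subset) X Y).symm

end ConnectionForm

end PrincipalBundle

end

theorem mainTheorem4_general
    {EM : Type*} [NormedAddCommGroup EM] [NormedSpace ℝ EM]
    {HM : Type*} [TopologicalSpace HM] (IM : ModelWithCorners ℝ EM HM)
    {EP : Type*} [NormedAddCommGroup EP] [NormedSpace ℝ EP]
    {HP : Type*} [TopologicalSpace HP] (IP : ModelWithCorners ℝ EP HP)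
    {EG : Type*} [NormedAddCommGroup EG] [NormedSpace ℝ EG]
    {HG : Type*} [TopologicalSpace HG] (IG : ModelWithCorners ℝ EG HG)
    {M : Type*} [TopologicalSpace M] [ChartedSpace HM M] [IsManifold IM ∞ M]
    {P : Type*} [TopologicalSpace P] [ChartedSpace HP P] [IsManifold IP ∞ P]
    [BoundarylessManifold IP P]
    {G : Type*} [TopologicalSpace G] [ChartedSpace HG G] [Group G] [LieGroup IG ∞ G]
    (B : PrincipalBundle IM IP IG M P G) :
    ∃ Φ : B.PrincipalConnection ≃
        {K : VectorValuedOneForm ((IM.prod IM).prod IG) B.GaugeSpace //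
          B.gaugeGroupoid.IsMultiplicative IM K ∧
          (∀ W, K.map (K.map W) = K.map W) ∧
          Set.range K.map = B.gaugeVertical},
      ∀ (θ : B.PrincipalConnection) (X Y : TangentBundle IP P),
        (Φ θ).1.map (B.tangentToGauge X Y) =
          B.tangentToGauge (θ.verticalProjection X) (θ.verticalProjection Y) := by
  refine ⟨.ofBijective (fun θ => ⟨θ.gaugeForm, θ.isMultiplicative_gaugeForm,
    θ.gaugeForm_map_gaugeForm_map, θ.range_gaugeForm_map⟩) ⟨?injective, ?surjective⟩,
    fun θ => θ.gaugeForm_map_tangentToGauge⟩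
  case injective =>
    exact fun _ _ h => PrincipalBundle.PrincipalConnection.gaugeForm_injective (Subtype.mk.inj h)
  case surjective =>
    rintro ⟨K, h_mul, h_idem, h_range⟩
    exact ⟨B.connectionOfForm h_idem h_range,
      Subtype.ext (B.gaugeForm_connectionOfForm h_idem h_range h_mul)⟩

theorem mainTheorem4
    {EM : Type*} [NormedAddCommGroup EM] [NormedSpace ℝ EM] [FiniteDimensional ℝ EM]
    {HM : Type*} [TopologicalSpace HM] (IM : ModelWithCorners ℝ EM HM) [IM.Boundaryless]
    {EP : Type*} [NormedAddCommGroup EP] [NormedSpace ℝ EP] [FiniteDimensional ℝ EP]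
    {HP : Type*} [TopologicalSpace HP] (IP : ModelWithCorners ℝ EP HP) [IP.Boundaryless]
    {EG : Type*} [NormedAddCommGroup EG] [NormedSpace ℝ EG] [FiniteDimensional ℝ EG]
    {HG : Type*} [TopologicalSpace HG] (IG : ModelWithCorners ℝ EG HG) [IG.Boundaryless]
    {M : Type*} [TopologicalSpace M] [ChartedSpace HM M] [IsManifold IM ∞ M]
    {P : Type*} [TopologicalSpace P] [ChartedSpace HP P] [IsManifold IP ∞ P]
    {G : Type*} [TopologicalSpace G] [ChartedSpace HG G] [Group G] [LieGroup IG ∞ G]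
    (B : PrincipalBundle IM IP IG M P G) :
    ∃ Φ : B.PrincipalConnection ≃
        {K : VectorValuedOneForm ((IM.prod IM).prod IG) B.GaugeSpace //
          B.gaugeGroupoid.IsMultiplicative IM K ∧
          (∀ W, K.map (K.map W) = K.map W) ∧
          Set.range K.map = B.gaugeVertical},
      ∀ (θ : B.PrincipalConnection) (X Y : TangentBundle IP P),
        (Φ θ).1.map (B.tangentToGauge X Y) =
          B.tangentToGauge (θ.verticalProjection X) (θ.verticalProjection Y) := by
  exact mainTheorem4_general IM IP IG B
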